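/- All matroids are finite. For a matroid $M$ on ground set $E$ with rank function $r$, let $L(M)$ be its lattice of flats and $$\chi(M,t)=\sum_{F\in L(M)}\mu(F)\,t^{\,r(M)-r(F)}\in\mathbb{Z}[t]$$ its characteristic polynomial, where $\mu(\hat 0)=1$ and $\mu(F)=-\sum_{G<F}\mu(G)$ for $F\neq\hat 0$ (sum over flats $G$). Write $M|X$ and $M/X$ for restriction and contraction, and $\mathrm{si}(M)$ for the simplification of $M$ (delete all loops and all but one element of each parallel class). A flat $X$ is \emph{modular} if $r(X)+r(Y)=r(X\cap Y)+r(X\vee Y)$ for every flat $Y$, where $X\vee Y$ is the closure of $X\cup Y$; a \emph{coatom} is a flat of corank $1$. A matroid is \emph{round} if its ground set is not the union of two proper flats. A simple matroid $M$ is the \emph{modular join} of $M|E_1$ and $M|E_2$ over $X=E_1\cap E_2$ if $E_1,E_2$ are proper modular flats of $M$ with $E=E_1\cup E_2$. Let $\mathcal{ME}$ (the \emph{modularly extended} matroids) be the smallest class of simple matroids such that (i) the empty matroid belongs to $\mathcal{ME}$; (ii) if a simple matroid $M$ has a modular coatom $X$ with $M|X\in\mathcal{ME}$, then $M\in\mathcal{ME}$;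 (iii) if a simple matroid $M$ is the modular join of $M_1,M_2\in\mathcal{ME}$ over a flat $X$ such that $M|X$ is round, then $M\in\mathcal{ME}$. A \emph{divisional flag} of a simple matroid $M$ of rank $n$ is a chain of flats $\varnothing=X_0\subseteq X_1\subseteq\dots\subseteq X_n=E$ with $r(X_i)=i$ for $0\le i\le n$ and $\chi(M/X_{i+1},t)\mid\chi(M/X_i,t)$ for $0\le i\le n-1$. An element $e$ of a simple matroid $M$ is a \emph{divisional atom} if $\chi(M/e,t)\mid\chi(M,t)$. A (central) arrangement $\mathcal{A}$ over a field $\mathbb{K}$ is a finite set of subspaces of codimension $1$ in a finite-dimensional $\mathbb{K}$-vector space; its linear dependence matroid $M(\mathcal{A})$ is the simple matroid on the set $\mathcal{A}$ in which $\{H_1,\dots,H_n\}\subseteq\mathcal{A}$ (the $H_i$ distinct) is independent if and only if $\operatorname{codim}(H_1\cap\dots\cap H_n)=n$. The arrangement $\mathcal{A}$ is \emph{divisionally free} if $M(\mathcal{A})$ has a divisional flag. \textbf{Theorem.} (a) Every modularly extended matroid has a divisional flag. (b) If the linear dependence matroid $M(\mathcal{A})$ of an arrangement $\mathcal{A}$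 over a field is modularly extended, then $\mathcal{A}$ is divisionally free. (c) Every modularly extended matroid $M$ with nonempty ground set has a divisional atom $e$ such that $\mathrm{si}(M/e)$ is again modularly extended. -/

import Mathlib

open Polynomial
open scoped Matroid

namespace ModularConstruction

section Matroids

variable {α : Type*}

/-- `M` is a simple matroid on a finite ground set: no loops (`e = f`) and no two
distinct parallel elements (`e ≠ f`). -/
structure IsSimple (M : Matroid α) : Prop where
  finite : M.Finite
  indep_pair : ∀ e ∈ M.E, ∀ f ∈ M.E, M.Indep {e, f}

/-- A modular flat: a modular element of the lattice of flats, in which the meet is the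
intersection and the join is the closure of the union. -/
structure IsModularFlat (M : Matroid α) (X : Set α) : Prop where
  isFlat : M.IsFlat X
  modular : ∀ Y, M.IsFlat Y →
    M.eRk X + M.eRk Y = M.eRk (X ∩ Y) + M.eRk (M.closure (X ∪ Y))

/-- A flat of corank one. -/
structure IsCoatomFlat (M : Matroid α) (X : Set α) : Prop where
  isFlat : M.IsFlat X
  corank_one : M.eRk X + 1 = M.eRank

/-- A matroid is round if its ground set is not the union of two proper flats. -/
def IsRound (M : Matroid α) : Prop :=
  ∀ F₁ F₂, M.IsFlat F₁ → M.IsFlat F₂ → F₁ ∪ F₂ = M.E → F₁ = M.E ∨ F₂ = M.E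

/-- `M` is the modular join of `M ↾ E₁` and `M ↾ E₂` (over `E₁ ∩ E₂`). -/
structure IsModularJoin (M : Matroid α) (E₁ E₂ : Set α) : Prop where
  modular_left : IsModularFlat M E₁
  modular_right : IsModularFlat M E₂
  proper_left : E₁ ≠ M.E
  proper_right : E₂ ≠ M.E
  union_eq : E₁ ∪ E₂ = M.E

/-- The class `ME` of modularly extended simple matroids. -/
inductive ModularlyExtended : Matroid α → Prop
  | empty : ModularlyExtended (Matroid.emptyOn α)
  | modularCoatom (M : Matroid α) (X : Set α) (hM : IsSimple M) (hX : IsModularFlat M X)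
      (hX' : IsCoatomFlat M X) (h : ModularlyExtended (M ↾ X)) : ModularlyExtended M
  | modularJoin (M : Matroid α) (E₁ E₂ : Set α) (hM : IsSimple M) (hE : IsModularJoin M E₁ E₂)
      (hround : IsRound (M ↾ (E₁ ∩ E₂))) (h₁ : ModularlyExtended (M ↾ E₁))
      (h₂ : ModularlyExtended (M ↾ E₂)) : ModularlyExtended M

/-- The lattice of flats of `M`, ordered by inclusion. -/
abbrev FlatLattice (M : Matroid α) : Type _ := {F : Set α // M.IsFlat F}

/-- The least flat. -/
def botFlat (M : Matroid α) : FlatLattice M := ⟨M.closure ∅, M.isFlat_closure ∅⟩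

instance flatLattice_finite (M : Matroid α) [M.Finite] : Finite (FlatLattice M) :=
  Set.Finite.subset M.ground_finite.finite_subsets fun _ hF => hF.subset_ground

open Classical in
/-- The one-variable Möbius function of the lattice of flats. -/
noncomputable def moebius (M : Matroid α) [M.Finite] (F : FlatLattice M) : ℤ :=
  letI : Fintype (FlatLattice M) := Fintype.ofFinite _
  letI : LocallyFiniteOrder (FlatLattice M) := Fintype.toLocallyFiniteOrder
  IncidenceAlgebra.mu ℤ (botFlat M) F

/-- The characteristic polynomial `χ(M, t) = ∑ μ(F) t ^ (r(M) - r(F))`, the sum being over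
all flats `F`; the exponent is a genuine difference because `r(F) ≤ r(M) < ∞`. -/
noncomputable def charPoly (M : Matroid α) [M.Finite] : ℤ[X] :=
  letI : Fintype (FlatLattice M) := Fintype.ofFinite _
  ∑ F : FlatLattice M, C (moebius M F) * X ^ (M.eRank.toNat - (M.eRk F.1).toNat)

/-- `X₀ ⊆ ⋯ ⊆ Xₙ` is a divisional flag of `M`. -/
structure IsDivisionalFlag (M : Matroid α) [M.Finite] (n : ℕ) (X : Fin (n + 1) → Set α) :
    Prop where
  rank_eq : M.eRank = n
  first : X 0 = ∅
  last : X (Fin.last n) = M.E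
  isFlat : ∀ i, M.IsFlat (X i)
  rank_flat : ∀ i, M.eRk (X i) = (i : ℕ)
  subset : ∀ i : Fin n, X i.castSucc ⊆ X i.succ
  dvd : ∀ i : Fin n, charPoly (M ／ X i.succ) ∣ charPoly (M ／ X i.castSucc)

/-- `M` has a divisional flag. -/
def HasDivisionalFlag (M : Matroid α) [M.Finite] : Prop :=
  ∃ (n : ℕ) (X : Fin (n + 1) → Set α), IsDivisionalFlag M n X

/-- A divisional atom of `M` (an atom of a simple matroid being an element of it). -/
def IsDivisionalAtom (M : Matroid α) [M.Finite] (e : α) : Prop :=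
  e ∈ M.E ∧ charPoly (M ／ {e}) ∣ charPoly M

/-- The simplification `si(M)`: delete all loops and all but one (chosen) element of each
parallel class. The parallel class of a nonloop `e` is `cl {e}` minus the loops, and that set
is empty if `e` is a loop or not in the ground set. -/
noncomputable def si (M : Matroid α) : Matroid α :=
  M ↾ {e | ∃ h : (M.closure {e} \ M.loops).Nonempty, e = h.some}

end Matroids

section Arrangements

variable {K V : Type*} [Field K] [AddCommGroup V] [Module K V] [FiniteDimensional K V]

/-- The codimension of the intersection of a set of subspaces (`0` for the empty set). -/
noncomputable def interCodim (I : Set (Submodule K V)) : ℕ := Module.finrank K (V ⧸ sInf I)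

theorem interCodim_mono {I J : Set (Submodule K V)} (h : sInf I ≤ sInf J) :
    interCodim J ≤ interCodim I := by
  have h1 := Submodule.finrank_quotient_add_finrank (sInf I)
  have h2 := Submodule.finrank_quotient_add_finrank (sInf J)
  have h3 := Submodule.finrank_mono h
  unfold interCodim
  omega

theorem interCodim_insert_le {H : Submodule K V} (hH : Module.finrank K (V ⧸ H) = 1)
    (I : Set (Submodule K V)) : interCodim (insert H I) ≤ interCodim I + 1 := by
  have h1 := Submodule.finrank_quotient_add_finrank (sInf I)
  have h2 := Submodule.finrank_quotient_add_finrank (sInf (insert H I))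
  have h3 := Submodule.finrank_quotient_add_finrank H
  have h4 := Submodule.finrank_sup_add_finrank_inf_eq H (sInf I)
  have h5 := Submodule.finrank_le (H ⊔ sInf I)
  rw [sInf_insert] at h2
  unfold interCodim
  rw [sInf_insert]
  omega

theorem sInf_le_of_interCodim_insert {H : Submodule K V} {I : Set (Submodule K V)}
    (h : interCodim (insert H I) ≤ interCodim I) : sInf I ≤ H := by
  have h1 := Submodule.finrank_quotient_add_finrank (sInf I)
  have h2 := Submodule.finrank_quotient_add_finrank (sInf (insert H I))
  unfold interCodim at h
  rw [sInf_insert] at h h2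
  have h3 : H ⊓ sInf I = sInf I :=
    Submodule.eq_of_le_of_finrank_le inf_le_right (by omega)
  exact inf_eq_right.mp h3

/-- A central hyperplane arrangement in `V`: a finite set of subspaces of codimension one. -/
structure Arrangement (K V : Type*) [Field K] [AddCommGroup V] [Module K V] where
  hyperplanes : Set (Submodule K V)
  finite : hyperplanes.Finite
  codim_one : ∀ H ∈ hyperplanes, Module.finrank K (V ⧸ H) = 1

theorem Arrangement.interCodim_le_add (A : Arrangement K V) (I : Set (Submodule K V))
    {T : Set (Submodule K V)} (hT : T ⊆ A.hyperplanes) :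
    interCodim (I ∪ T) ≤ interCodim I + T.ncard := by
  have hfin := A.finite.subset hT
  induction T, hfin using Set.Finite.induction_on with
  | empty => simp
  | @insert a s ha hs ih =>
    rw [Set.union_insert, Set.ncard_insert_of_notMem ha hs]
    have h1 := interCodim_insert_le (A.codim_one a (hT (Set.mem_insert _ _))) (I ∪ s)
    have h2 := ih ((Set.subset_insert _ _).trans hT)
    omega

theorem interCodim_empty : interCodim (∅ : Set (Submodule K V)) = 0 := by
  have h := Submodule.finrank_quotient_add_finrank (⊤ : Submodule K V)
  have h' := finrank_top K V
  unfold interCodim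
  rw [sInf_empty]
  omega

/-- The linear dependence matroid `M(A)` on the set of hyperplanes of `A`: hyperplanes
`H₁, …, Hₙ` are independent if `H₁ ∩ ⋯ ∩ Hₙ` has codimension `n`. -/
noncomputable def Arrangement.matroid (A : Arrangement K V) : Matroid (Submodule K V) :=
  (IndepMatroid.ofFinite A.finite
    (Indep := fun I => I ⊆ A.hyperplanes ∧ interCodim I = I.ncard)
    (indep_empty := ⟨Set.empty_subset _, by rw [interCodim_empty, Set.ncard_empty]⟩)
    (indep_subset := by
      rintro I J ⟨hJ, hJc⟩ hIJ
      refine ⟨hIJ.trans hJ, ?_⟩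
      have hJf := A.finite.subset hJ
      have h1 := A.interCodim_le_add I (T := J \ I) (Set.sdiff_subset.trans hJ)
      have h2 := A.interCodim_le_add ∅ (hIJ.trans hJ)
      have h3 := Set.ncard_sdiff_add_ncard_of_subset hIJ hJf
      rw [Set.union_sdiff_cancel hIJ] at h1
      rw [Set.empty_union, interCodim_empty] at h2
      omega)
    (indep_aug := by
      rintro I J ⟨hI, hIc⟩ ⟨hJ, hJc⟩ hlt
      by_contra! hcon
      have hle : sInf I ≤ sInf J := by
        refine le_sInf fun H hH => ?_
        by_cases hHI : H ∈ I
        · exact sInf_le hHI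
        · refine sInf_le_of_interCodim_insert ?_
          have h1 := interCodim_insert_le (A.codim_one H (hJ hH)) I
          have h2 : interCodim (insert H I) ≠ (insert H I).ncard := fun h =>
            hcon H hH hHI (Set.insert_subset (hJ hH) hI) h
          rw [Set.ncard_insert_of_notMem hHI (A.finite.subset hI)] at h2
          omega
      have := interCodim_mono hle
      omega)
    (subset_ground := fun _ h => h.1)).matroid

instance Arrangement.matroid_finite (A : Arrangement K V) : A.matroid.Finite := ⟨A.finite⟩

/-- An arrangement is divisionally free if its matroid has a divisional flag. -/
def Arrangement.DivisionallyFree (A : Arrangement K V) : Prop := HasDivisionalFlag A.matroid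

end Arrangements

end ModularConstruction

open ModularConstruction

/-! The core is a statement stronger than (c), proved by induction on the construction of M in
`ModularlyExtended.exists_divisional`: outside every proper round flat X there is an element e with
χ(M/e) dividing χ(M) and M/e modularly extended up to simplification. Part (c) is the case X = ∅.
Iterating (c) and lifting flags through contractions (`HasDivisionalFlag.of_contractElem`) gives
(a), and (b) is an instance of (a).

Divisibility rests on Stanley's factorization χ(M) = χ(M|Y) · q for a modular flat Y
(`charPoly_eq_mul`), with cofactor q = `complPoly M Y`. If X is a flat with X ∪ Y = E and e ∈ Y \ X,
contracting e leaves the cofactor unchanged (`complPoly_contractElem`), so divisibility passes from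
M|Y to M.

For a modular coatom Y there are two cases. If some e lies outside X ∪ Y, projection from e onto Y
shows that M/e simplifies to M|Y, whose characteristic polynomial divides that of M. If X ∪ Y = E,
then X ∩ Y is again round (`IsRound.inter_modularCoatom`), and the induction hypothesis inside Y
supplies e.

For a modular join, roundness puts X inside one side, say E₁. The induction hypothesis for E₂ and
the round flat E₁ ∩ E₂ gives e ∈ E₂ \ E₁, and M/e is either a modular join of contracted sides or
parallel to M|E₁ (`weakModularlyExtended_contractElem_of_join`).

Contractions of simple matroids need not be simple. The induction therefore uses
`WeakModularlyExtended`, a class insensitive to loops and parallel elements; `IsParallelDense`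
records what passing to a simplification preserves. -/

namespace ModularConstruction

/-! ### Natural-number ranks, flats of minors, modular flats, simplicity -/

section Rank

variable {α : Type*} {M N : Matroid α} {A B F G R S X Y Z : Set α} {e f : α}

/-- The rank of a set as a natural number. -/
noncomputable def rk (M : Matroid α) (A : Set α) : ℕ := (M.eRk A).toNat

theorem coe_rk (M : Matroid α) [M.RankFinite] (A : Set α) : (rk M A : ℕ∞) = M.eRk A :=
  ENat.natCast_toNat (Matroid.eRk_ne_top_iff.2 (M.isRkFinite_set A))

theorem rk_mono (M : Matroid α) [M.RankFinite] (h : A ⊆ B) : rk M A ≤ rk M B := by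
  have := M.eRk_mono h
  rw [← coe_rk, ← coe_rk] at this
  exact_mod_cast this

theorem rk_submod (M : Matroid α) [M.RankFinite] (A B : Set α) :
    rk M (A ∩ B) + rk M (A ∪ B) ≤ rk M A + rk M B := by
  have := M.eRk_inter_add_eRk_union_le A B
  simp only [← coe_rk] at this
  exact_mod_cast this

@[simp] theorem rk_closure (M : Matroid α) (A : Set α) : rk M (M.closure A) = rk M A := by
  rw [rk, rk, M.eRk_closure_eq]

@[simp] theorem rk_empty (M : Matroid α) : rk M ∅ = 0 := by simp [rk]

@[simp] theorem rk_loops (M : Matroid α) : rk M M.loops = 0 := by simp [rk]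

theorem rk_congr_closure (h : M.closure A = M.closure B) : rk M A = rk M B := by
  rw [← rk_closure, h, rk_closure]

theorem rk_union_closure_left (M : Matroid α) (A B : Set α) :
    rk M (M.closure A ∪ B) = rk M (A ∪ B) :=
  rk_congr_closure (by simp)

theorem rk_restrict (M : Matroid α) (h : A ⊆ R) : rk (M ↾ R) A = rk M A := by
  rw [rk, rk, M.restrict_eRk_eq h]

theorem rk_insert_of_notMem (M : Matroid α) [M.RankFinite] (he : e ∈ M.E)
    (h : e ∉ M.closure A) : rk M (insert e A) = rk M A + 1 := by
  have := Matroid.eRk_insert_eq_add_one (M := M) ⟨he, h⟩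
  simp only [← coe_rk] at this
  exact_mod_cast this

theorem rk_insert_le (M : Matroid α) [M.RankFinite] (e : α) (A : Set α) :
    rk M (insert e A) ≤ rk M A + 1 := by
  have := M.eRk_insert_le_add_one e A
  simp only [← coe_rk] at this
  exact_mod_cast this

theorem rk_insert_of_flat [M.RankFinite] (hF : M.IsFlat F) (he : e ∈ M.E) (h : e ∉ F) :
    rk M (insert e F) = rk M F + 1 :=
  rk_insert_of_notMem M he (by rwa [hF.closure])

theorem rk_singleton [M.RankFinite] (he : M.IsNonloop e) : rk M {e} = 1 := by
  rw [rk, he.eRk_eq]; rfl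

theorem exists_isNonloop_of_rk_pos [M.RankFinite] (hA : A ⊆ M.E) (h : 0 < rk M A) :
    ∃ e ∈ A, M.IsNonloop e := by
  by_contra! hc
  have : M.eRk A = 0 := by
    rw [Matroid.eRk_eq_zero_iff hA]
    exact fun x hx => Matroid.isLoop_of_not_isNonloop (hA hx) (hc x hx)
  simp [rk, this] at h

theorem closure_eq_of_rk_le [M.RankFinite] (hAB : A ⊆ B) (h : rk M B ≤ rk M A) :
    M.closure A = M.closure B := by
  refine (M.isRkFinite_set A).closure_eq_closure_of_subset_of_eRk_ge_eRk hAB ?_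
  rw [← coe_rk, ← coe_rk]
  exact_mod_cast h

theorem eq_of_rk_le [M.RankFinite] (hF : M.IsFlat F) (hFA : F ⊆ A) (hA : A ⊆ M.E)
    (h : rk M A ≤ rk M F) : F = A := by
  have := closure_eq_of_rk_le hFA h
  rw [hF.closure] at this
  exact hFA.antisymm (this ▸ M.subset_closure A hA)

theorem rk_lt_of_notMem [M.RankFinite] (hF : M.IsFlat F) (hFA : F ⊆ A) (hA : A ⊆ M.E)
    (heA : e ∈ A) (heF : e ∉ F) : rk M F < rk M A := by
  by_contra! h
  exact heF (eq_of_rk_le hF hFA hA h ▸ heA)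

/-- A basis of `insert e A` through e becomes a basis in the contraction once e is dropped. The
additive form avoids truncated subtraction, and A may contain e. -/
theorem rk_contractElem [M.RankFinite] (he : M.IsNonloop e) (A : Set α) :
    rk (M ／ {e}) A + 1 = rk M (insert e A) := by
  obtain ⟨J, hJ, heJ⟩ := he.indep.subset_isBasis'_of_subset
    (show {e} ⊆ insert e A by simp)
  have h1 := hJ.contract_isBasis'_sdiff_sdiff_of_subset heJ
  have h2 : (M ／ {e}).eRk (insert e A \ {e}) = (M ／ {e}).eRk A := by
    rw [← Matroid.eRk_inter_ground, ← (M ／ {e}).eRk_inter_ground A]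
    congr 1
    ext x
    simp only [Matroid.contract_ground, Set.mem_inter_iff, Set.mem_sdiff, Set.mem_insert_iff,
      Set.mem_singleton_iff]
    tauto
  have h3 : (M ／ {e}).eRk A + 1 = M.eRk (insert e A) := by
    rw [← h2, h1.eRk_eq_encard, hJ.eRk_eq_encard,
      Set.encard_sdiff_singleton_add_one (heJ rfl)]
  simp only [← coe_rk] at h3
  exact_mod_cast h3

theorem isFlat_inter (hF : M.IsFlat F) (hG : M.IsFlat G) : M.IsFlat (F ∩ G) := by
  rw [Matroid.isFlat_iff_closure_eq]
  refine (Set.subset_inter ?_ ?_).antisymm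
    (M.subset_closure _ (Set.inter_subset_left.trans hF.subset_ground))
  · exact (M.closure_subset_closure Set.inter_subset_left).trans hF.closure.subset
  · exact (M.closure_subset_closure Set.inter_subset_right).trans hG.closure.subset

theorem closure_subset_flat (hF : M.IsFlat F) (h : A ⊆ F) : M.closure A ⊆ F :=
  (M.closure_subset_closure h).trans hF.closure.subset

theorem isFlat_restrict_iff (hR : R ⊆ M.E) :
    (M ↾ R).IsFlat F ↔ F ⊆ R ∧ M.closure F ∩ R = F := by
  rw [Matroid.isFlat_iff_closure_eq]
  constructor
  · intro h
    have hF : F ⊆ R := h ▸ (M ↾ R).closure_subset_ground F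
    rw [M.restrict_closure_eq hF hR] at h
    exact ⟨hF, h⟩
  · rintro ⟨h1, h2⟩
    rw [M.restrict_closure_eq h1 hR, h2]

theorem isFlat_restrict_flat_iff (hX : M.IsFlat X) :
    (M ↾ X).IsFlat F ↔ M.IsFlat F ∧ F ⊆ X := by
  rw [isFlat_restrict_iff hX.subset_ground]
  constructor
  · rintro ⟨h1, h2⟩
    rw [Set.inter_eq_left.2 (closure_subset_flat hX h1)] at h2
    exact ⟨Matroid.isFlat_iff_closure_eq.2 h2, h1⟩
  · rintro ⟨h1, h2⟩
    exact ⟨h2, by rw [h1.closure, Set.inter_eq_left.2 h2]⟩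

theorem isFlat_inter_restrict (hR : R ⊆ M.E) (hF : M.IsFlat F) : (M ↾ R).IsFlat (F ∩ R) :=
  (isFlat_restrict_iff hR).2 ⟨Set.inter_subset_right,
    (Set.subset_inter
      (Set.inter_subset_left.trans (closure_subset_flat hF Set.inter_subset_left))
      Set.inter_subset_right).antisymm
      (Set.subset_inter (M.subset_closure _ (Set.inter_subset_right.trans hR))
        Set.inter_subset_right)⟩

theorem isFlat_contractElem_iff (he : e ∈ M.E) :
    (M ／ {e}).IsFlat F ↔ e ∉ F ∧ M.IsFlat (insert e F) := by
  rw [Matroid.isFlat_iff_closure_eq, Matroid.contract_closure_eq, Set.union_singleton,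
    Matroid.isFlat_iff_closure_eq]
  constructor
  · intro h
    have heF : e ∉ F := fun h' => by rw [← h] at h'; exact h'.2 rfl
    have heC : e ∈ M.closure (insert e F) := M.mem_closure_of_mem' (by simp) he
    refine ⟨heF, ?_⟩
    conv_rhs => rw [← h]
    rw [Set.insert_sdiff_singleton, Set.insert_eq_of_mem heC]
  · rintro ⟨h1, h2⟩
    rw [h2]
    simp [h1]

/-- In natural-number form, with the closure removed from the join, modularity can be combined with
submodularity by linear arithmetic. -/
theorem isModularFlat_iff [M.RankFinite] :
    IsModularFlat M X ↔ M.IsFlat X ∧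
      ∀ Y, M.IsFlat Y → rk M X + rk M Y = rk M (X ∩ Y) + rk M (X ∪ Y) := by
  have key : ∀ Y, (M.eRk X + M.eRk Y = M.eRk (X ∩ Y) + M.eRk (M.closure (X ∪ Y))) ↔
      rk M X + rk M Y = rk M (X ∩ Y) + rk M (X ∪ Y) := by
    intro Y
    rw [M.eRk_closure_eq]
    simp only [← coe_rk]
    norm_cast
  exact ⟨fun h => ⟨h.1, fun Y hY => (key Y).1 (h.2 Y hY)⟩,
    fun h => ⟨h.1, fun Y hY => (key Y).2 (h.2 Y hY)⟩⟩

theorem IsModularFlat.rk_eq [M.RankFinite] (hX : IsModularFlat M X) (hY : M.IsFlat Y) :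
    rk M X + rk M Y = rk M (X ∩ Y) + rk M (X ∪ Y) :=
  (isModularFlat_iff.1 hX).2 Y hY

theorem isCoatomFlat_iff [M.RankFinite] :
    IsCoatomFlat M X ↔ M.IsFlat X ∧ rk M X + 1 = rk M M.E := by
  have key : (M.eRk X + 1 = M.eRank) ↔ rk M X + 1 = rk M M.E := by
    rw [M.eRank_def]
    simp only [← coe_rk]
    norm_cast
  exact ⟨fun h => ⟨h.1, key.1 h.2⟩, fun h => ⟨h.1, key.2 h.2⟩⟩

theorem IsSimple.isNonloop (hM : IsSimple M) (he : e ∈ M.E) : M.IsNonloop e := by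
  have := hM.indep_pair e he e he
  rwa [Set.pair_eq_singleton, Matroid.indep_singleton] at this

theorem IsSimple.loops_eq (hM : IsSimple M) : M.loops = ∅ := by
  refine Set.eq_empty_of_forall_notMem fun x hx => ?_
  exact Matroid.IsLoop.not_isNonloop hx (hM.isNonloop (M.loops_subset_ground hx))

theorem IsSimple.isFlat_empty (hM : IsSimple M) : M.IsFlat ∅ := by
  rw [← hM.loops_eq]
  exact M.isFlat_closure ∅

theorem IsSimple.isFlat_singleton (hM : IsSimple M) (he : e ∈ M.E) : M.IsFlat {e} := by
  rw [Matroid.isFlat_iff_closure_eq]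
  refine Set.Subset.antisymm (fun x hx => ?_) (M.subset_closure {e} (by simpa))
  have hx' := M.closure_subset_ground _ hx
  by_contra hne
  have := hM.indep_pair x hx' e he
  exact ((hM.isNonloop he).indep.notMem_closure_iff_of_notMem hne hx').2 this hx

theorem IsSimple.rk_pair [M.RankFinite] (hM : IsSimple M) (he : e ∈ M.E) (hf : f ∈ M.E)
    (hef : e ≠ f) : rk M {e, f} = 2 := by
  rw [rk, (hM.indep_pair e he f hf).eRk_eq_encard, Set.encard_pair hef]; rfl

theorem IsSimple.restrict (hM : IsSimple M) (hX : X ⊆ M.E) : IsSimple (M ↾ X) where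
  finite := Matroid.restrict_finite (hM.finite.ground_finite.subset hX)
  indep_pair e he f hf := by
    rw [Matroid.restrict_indep_iff]
    exact ⟨hM.indep_pair e (hX he) f (hX hf), Set.pair_subset he hf⟩

end Rank

/-! ### The Möbius function and characteristic polynomial under lattice isomorphisms -/

section Moebius

variable {α : Type*} {M N : Matroid α} {A B F G R S X Y Z : Set α} {e f : α}

theorem finite_setOf_isFlat (M : Matroid α) [M.Finite] : {F | M.IsFlat F}.Finite :=
  M.ground_finite.finite_subsets.subset fun _ hF => Matroid.IsFlat.subset_ground hF

/-- The finite set of flats. -/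
noncomputable def flats (M : Matroid α) [M.Finite] : Finset (Set α) :=
  (finite_setOf_isFlat M).toFinset

@[simp] theorem mem_flats [M.Finite] : F ∈ flats M ↔ M.IsFlat F := by
  simp [flats]

open Classical in
/-- The Möbius function of the lattice of flats, extended by zero to all sets. -/
noncomputable def mob (M : Matroid α) [M.Finite] (F : Set α) : ℤ :=
  if h : M.IsFlat F then moebius M ⟨F, h⟩ else 0

theorem sum_flatLattice {β : Type*} [AddCommMonoid β] (M : Matroid α) [M.Finite]
    [Fintype (FlatLattice M)] (g : Set α → β) :
    ∑ F : FlatLattice M, g F.1 = ∑ F ∈ flats M, g F := by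
  refine Finset.sum_bij (fun F _ => F.1) ?_ ?_ ?_ ?_
  · exact fun F _ => mem_flats.2 F.2
  · exact fun F _ G _ h => Subtype.ext h
  · exact fun F hF => ⟨⟨F, mem_flats.1 hF⟩, Finset.mem_univ _, rfl⟩
  · exact fun _ _ => rfl

theorem charPoly_eq_sum (M : Matroid α) [M.Finite] :
    charPoly M = ∑ F ∈ flats M, C (mob M F) * (Polynomial.X : ℤ[X]) ^ (rk M M.E - rk M F) := by
  classical
  let _ : Fintype (FlatLattice M) := Fintype.ofFinite _
  rw [← sum_flatLattice, charPoly]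
  refine Finset.sum_congr (by congr!) fun F _ => ?_
  rw [mob, dif_pos F.2, rk, rk, M.eRk_ground]

open Classical in
theorem sum_mob [M.Finite] (hF : M.IsFlat F) :
    ∑ G ∈ flats M with G ⊆ F, mob M G = if F = M.loops then 1 else 0 := by
  let _ : Fintype (FlatLattice M) := Fintype.ofFinite _
  let _ : LocallyFiniteOrder (FlatLattice M) := Fintype.toLocallyFiniteOrder
  have h := IncidenceAlgebra.sum_Icc_mu_right (𝕜 := ℤ) (botFlat M) ⟨F, hF⟩
  have h1 : (botFlat M = ⟨F, hF⟩) ↔ F = M.loops := by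
    rw [botFlat, Subtype.mk.injEq]
    exact eq_comm
  simp only [h1] at h
  rw [← h]
  symm
  refine Finset.sum_bij (fun G _ => G.1) ?_ ?_ ?_ ?_
  · intro G hG
    rw [Finset.mem_filter, mem_flats]
    exact ⟨G.2, (Finset.mem_Icc.1 hG).2⟩
  · exact fun F _ G _ h => Subtype.ext h
  · intro G hG
    rw [Finset.mem_filter, mem_flats] at hG
    exact ⟨⟨G, hG.1⟩, Finset.mem_Icc.2 ⟨hG.1.loops_subset, hG.2⟩, rfl⟩
  · intro G _
    rw [mob, dif_pos G.2, moebius]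

open Classical in
/-- The defining recursion below `F` determines the Möbius function at `F`. -/
theorem eq_mob_of_sum_eq [M.Finite] (hF : M.IsFlat F) (g : Set α → ℤ)
    (hg : ∀ W, M.IsFlat W → W ⊆ F →
      ∑ G ∈ flats M with G ⊆ W, g G = if W = M.loops then 1 else 0) :
    g F = mob M F := by
  induction h : F.ncard using Nat.strong_induction_on generalizing F with
  | _ n ih =>
    have hmem : F ∈ (flats M).filter (· ⊆ F) := by simp [hF]
    have h1 := hg F hF subset_rfl
    rw [← sum_mob hF, ← Finset.add_sum_erase _ _ hmem, ← Finset.add_sum_erase _ _ hmem] at h1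
    have h2 : ∑ G ∈ ((flats M).filter (· ⊆ F)).erase F, g G =
        ∑ G ∈ ((flats M).filter (· ⊆ F)).erase F, mob M G := by
      refine Finset.sum_congr rfl fun G hG => ?_
      rw [Finset.mem_erase, Finset.mem_filter, mem_flats] at hG
      obtain ⟨hne, hGf, hGF⟩ := hG
      refine ih G.ncard ?_ hGf (fun W hW hWG => hg W hW (hWG.trans hGF)) rfl
      rw [← h]
      exact Set.ncard_lt_ncard (hGF.ssubset_of_ne hne)
        (M.ground_finite.subset hF.subset_ground)
    linarith

/-- The Möbius function only depends on the order structure of the flats below. -/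
theorem mob_congr [M.Finite] [N.Finite] (φ : Set α → Set α) (hF : M.IsFlat F)
    (hφ : ∀ G, M.IsFlat G → G ⊆ F → N.IsFlat (φ G))
    (hle : ∀ G H, M.IsFlat G → M.IsFlat H → G ⊆ F → H ⊆ F → (φ G ⊆ φ H ↔ G ⊆ H))
    (hsurj : ∀ H, N.IsFlat H → H ⊆ φ F → ∃ G, M.IsFlat G ∧ G ⊆ F ∧ φ G = H) :
    mob N (φ F) = mob M F := by
  classical
  refine eq_mob_of_sum_eq hF (fun G => mob N (φ G)) fun W hW hWF => ?_
  -- The order isomorphism matches least flats, so the right-hand sides of the two recursions agree.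
  have hbot : φ W = N.loops ↔ W = M.loops := by
    have hl : M.IsFlat M.loops := M.isFlat_closure ∅
    have hlF := hF.loops_subset
    obtain ⟨G, hG, hGF, hGl⟩ := hsurj N.loops (N.isFlat_closure ∅) (hφ F hF subset_rfl).loops_subset
    have hGl' : G = M.loops := by
      refine ((hle _ _ hG hl hGF hlF).1 ?_).antisymm hG.loops_subset
      rw [hGl]
      exact (hφ _ hl hlF).loops_subset
    rw [← hGl', ← hGl]
    exact ⟨fun h => ((hle _ _ hW hG hWF hGF).1 h.subset).antisymm
      ((hle _ _ hG hW hGF hWF).1 h.superset), fun h => by rw [h]⟩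
  rw [← if_congr hbot rfl rfl, ← sum_mob (hφ W hW hWF)]
  refine Finset.sum_bij (fun G _ => φ G) ?_ ?_ ?_ ?_
  · intro G hG
    rw [Finset.mem_filter, mem_flats] at hG ⊢
    exact ⟨hφ G hG.1 (hG.2.trans hWF), (hle _ _ hG.1 hW (hG.2.trans hWF) hWF).2 hG.2⟩
  · intro G hG H hH h
    rw [Finset.mem_filter, mem_flats] at hG hH
    have hGF := hG.2.trans hWF
    have hHF := hH.2.trans hWF
    exact ((hle _ _ hG.1 hH.1 hGF hHF).1 h.subset).antisymm
      ((hle _ _ hH.1 hG.1 hHF hGF).1 h.superset)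
  · intro H hH
    rw [Finset.mem_filter, mem_flats] at hH
    obtain ⟨G, hG, hGF, rfl⟩ := hsurj H hH.1
      (hH.2.trans ((hle _ _ hW hF hWF subset_rfl).2 hWF))
    exact ⟨G, by simpa [hG] using (hle _ _ hG hW hGF hWF).1 hH.2, rfl⟩
  · exact fun _ _ => rfl

theorem mob_congr_of_forall_subset [M.Finite] [N.Finite] (hF : M.IsFlat F)
    (h : ∀ G ⊆ F, M.IsFlat G ↔ N.IsFlat G) : mob N F = mob M F :=
  mob_congr id hF (fun G hG hGF => (h G hGF).1 hG) (fun _ _ _ _ _ _ => Iff.rfl)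
    fun H hH hHF => ⟨H, (h H hHF).2 hH, hHF, rfl⟩

/-- A rank-preserving isomorphism of lattices of flats matches the defining sums term by term. -/
theorem charPoly_congr [M.Finite] [N.Finite] (φ : Set α → Set α)
    (hφ : ∀ G, M.IsFlat G → N.IsFlat (φ G))
    (hle : ∀ G H, M.IsFlat G → M.IsFlat H → (φ G ⊆ φ H ↔ G ⊆ H))
    (hsurj : ∀ H, N.IsFlat H → ∃ G, M.IsFlat G ∧ φ G = H)
    (hrk : ∀ G, M.IsFlat G → rk N (φ G) = rk M G) (hE : rk N N.E = rk M M.E) :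
    charPoly N = charPoly M := by
  rw [charPoly_eq_sum, charPoly_eq_sum]
  symm
  refine Finset.sum_bij (fun G _ => φ G) ?_ ?_ ?_ ?_
  · exact fun G hG => mem_flats.2 (hφ G (mem_flats.1 hG))
  · intro G hG H hH h
    rw [mem_flats] at hG hH
    exact ((hle _ _ hG hH).1 h.subset).antisymm ((hle _ _ hH hG).1 h.superset)
  · intro H hH
    obtain ⟨G, hG, rfl⟩ := hsurj H (mem_flats.1 hH)
    exact ⟨G, mem_flats.2 hG, rfl⟩
  · intro G hG
    rw [mem_flats] at hG
    have : mob N (φ G) = mob M G := by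
      refine mob_congr φ hG (fun G' h _ => hφ G' h) (fun G' H h h' _ _ => hle _ _ h h') ?_
      intro H hH hHG
      obtain ⟨G', hG', rfl⟩ := hsurj H hH
      exact ⟨G', hG', (hle _ _ hG' hG).1 hHG, rfl⟩
    rw [this, hrk G hG, hE]

/-! ### Stanley's factorization over a modular flat -/

open Classical in
/-- The cofactor of `χ(M ↾ X)` in `χ(M)` for a modular flat `X`. -/
noncomputable def complPoly (M : Matroid α) [M.Finite] (X : Set α) : ℤ[X] :=
  ∑ F ∈ flats M with F ∩ X = M.loops,
    C (mob M F) * (Polynomial.X : ℤ[X]) ^ (rk M M.E - rk M X - rk M F)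

open Classical in
/-- Every flat `X` factors the Möbius function as a convolution over joins. -/
theorem sum_mob_mul_mob [M.Finite] (hX : M.IsFlat X) (hF : M.IsFlat F) :
    ∑ p ∈ (flats M).filter (· ⊆ X) ×ˢ (flats M).filter (fun Z => Z ∩ X = M.loops)
      with M.closure (p.1 ∪ p.2) = F, mob M p.1 * mob M p.2 = mob M F := by
  set P := (flats M).filter (· ⊆ X) ×ˢ (flats M).filter (fun Z => Z ∩ X = M.loops)
  refine eq_mob_of_sum_eq hF
    (fun F => ∑ p ∈ P with M.closure (p.1 ∪ p.2) = F, mob M p.1 * mob M p.2)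
    fun W hW _ => ?_
  -- A join lies in the flat W exactly when both parts do. Summing over all G ⊆ W thus removes the
  -- condition on the join and makes the sum a product.
  have h1 : ∑ G ∈ flats M with G ⊆ W,
      ∑ p ∈ P with M.closure (p.1 ∪ p.2) = G, mob M p.1 * mob M p.2 =
      ∑ p ∈ P with p.1 ⊆ W ∧ p.2 ⊆ W, mob M p.1 * mob M p.2 := by
    rw [← Finset.sum_fiberwise_of_maps_to (s := P.filter fun p => p.1 ⊆ W ∧ p.2 ⊆ W)
      (t := (flats M).filter (· ⊆ W)) (g := fun p => M.closure (p.1 ∪ p.2))]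
    · refine Finset.sum_congr rfl fun G hG => Finset.sum_congr ?_ fun _ _ => rfl
      rw [Finset.mem_filter, mem_flats] at hG
      ext p
      simp only [Finset.mem_filter, P, Finset.mem_product, mem_flats]
      constructor
      · rintro ⟨⟨⟨hp1, hp1X⟩, hp2, hp2X⟩, rfl⟩
        have hsub := M.subset_closure (p.1 ∪ p.2)
          (Set.union_subset hp1.subset_ground hp2.subset_ground)
        exact ⟨⟨⟨⟨hp1, hp1X⟩, hp2, hp2X⟩, Set.subset_union_left.trans (hsub.trans hG.2),
          Set.subset_union_right.trans (hsub.trans hG.2)⟩, rfl⟩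
      · rintro ⟨⟨h, _⟩, h'⟩
        exact ⟨h, h'⟩
    · intro p hp
      simp only [Finset.mem_filter, mem_flats] at hp ⊢
      exact ⟨M.isFlat_closure _, closure_subset_flat hW (Set.union_subset hp.2.1 hp.2.2)⟩
  have h2 : (P.filter fun p => p.1 ⊆ W ∧ p.2 ⊆ W) =
      (flats M).filter (· ⊆ X ∩ W) ×ˢ
        (flats M).filter (fun Z => Z ∩ X = M.loops ∧ Z ⊆ W) := by
    ext p
    simp only [Finset.mem_filter, P, Finset.mem_product, Set.subset_inter_iff]
    tauto
  rw [h1, h2, Finset.sum_product, ← Finset.sum_mul_sum, sum_mob (isFlat_inter hX hW)]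
  -- The first factor is 1 or 0 according to whether X ∩ W is the least flat. If it is, the
  -- condition Z ∩ X = loops holds for every flat Z ⊆ W, and the second factor is the full Möbius
  -- sum over W.
  by_cases hXW : X ∩ W = M.loops
  · rw [if_pos hXW, one_mul, ← sum_mob hW]
    refine Finset.sum_congr (Finset.filter_congr fun Z hZ => ?_) fun _ _ => rfl
    refine ⟨fun h => h.2, fun h => ⟨?_, h⟩⟩
    refine Set.Subset.antisymm ?_ (isFlat_inter (mem_flats.1 hZ) hX).loops_subset
    rw [← hXW]
    exact Set.subset_inter Set.inter_subset_right (Set.inter_subset_left.trans h)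
  · rw [if_neg hXW, zero_mul, if_neg]
    rintro rfl
    exact hXW (Set.inter_eq_right.2 hX.loops_subset)

theorem rk_union_add_of_inter_eq_loops [M.RankFinite] (hX : IsModularFlat M X) (hZ : M.IsFlat Z)
    (hXZ : Z ∩ X = M.loops) : rk M (X ∪ Z) = rk M X + rk M Z := by
  have h := hX.rk_eq hZ
  rw [Set.inter_comm, hXZ, rk_loops] at h
  omega

/-- Submodularity for X and A ∪ Z, whose intersection contains A, carries the rank additivity of X
and Z down to A and Z. -/
theorem IsModularFlat.rk_union_of_subset [M.RankFinite] (hX : IsModularFlat M X)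
    (hAX : A ⊆ X) (hZ : M.IsFlat Z) (hXZ : Z ∩ X = M.loops) :
    rk M (A ∪ Z) = rk M A + rk M Z := by
  have h1 := rk_union_add_of_inter_eq_loops hX hZ hXZ
  have h2 := rk_submod M X (A ∪ Z)
  rw [← Set.union_assoc, Set.union_eq_left.2 hAX] at h2
  have h3 := rk_mono M (Set.subset_inter hAX (Set.subset_union_left (s := A) (t := Z)))
  have h4 := rk_submod M A Z
  omega

theorem flats_restrict_filter (hX : M.IsFlat X) [M.Finite] [(M ↾ X).Finite]
    [DecidablePred (· ⊆ X)] : flats (M ↾ X) = (flats M).filter (· ⊆ X) := by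
  ext F
  simp [isFlat_restrict_flat_iff hX]

theorem mob_restrict (hX : M.IsFlat X) [M.Finite] [(M ↾ X).Finite] (hF : M.IsFlat F)
    (hFX : F ⊆ X) : mob (M ↾ X) F = mob M F :=
  mob_congr_of_forall_subset hF fun G hG => by
    rw [isFlat_restrict_flat_iff hX, and_iff_left (hG.trans hFX)]

/-- Stanley's modular factorization of the characteristic polynomial. -/
theorem charPoly_eq_mul (hX : IsModularFlat M X) [M.Finite] [(M ↾ X).Finite] :
    charPoly M = charPoly (M ↾ X) * complPoly M X := by
  classical
  have hXf := hX.isFlat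
  rw [charPoly_eq_sum, charPoly_eq_sum (M ↾ X), complPoly, flats_restrict_filter hXf,
    Finset.sum_mul_sum, ← Finset.sum_product']
  -- The product expands over pairs (flat below X, flat meeting X trivially). Grouping pairs by
  -- their join reduces the claim to the Möbius convolution and to additivity of rank.
  rw [← Finset.sum_fiberwise_of_maps_to (t := flats M)
    (g := fun p : Set α × Set α => M.closure (p.1 ∪ p.2))
    (fun p _ => mem_flats.2 (M.isFlat_closure _))]
  refine Finset.sum_congr rfl fun F hF => ?_
  rw [← sum_mob_mul_mob hXf (mem_flats.1 hF), map_sum, Finset.sum_mul]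
  refine Finset.sum_congr rfl fun p hp => ?_
  simp only [Finset.mem_filter, Finset.mem_product, mem_flats] at hp
  obtain ⟨⟨⟨hp1, hp1X⟩, hp2, hp2X⟩, rfl⟩ := hp
  rw [mob_restrict hXf hp1 hp1X, rk_restrict M hp1X, Matroid.restrict_ground_eq,
    rk_restrict M (subset_refl X), rk_closure,
    hX.rk_union_of_subset hp1X hp2 hp2X, mul_mul_mul_comm, ← pow_add, map_mul]
  congr 2
  have h1 := rk_mono M hp1X
  have h2 := rk_union_add_of_inter_eq_loops hX hp2 hp2X
  have h3 := rk_mono M (Set.union_subset hXf.subset_ground hp2.subset_ground)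
  omega

end Moebius

/-! ### Sets meeting every parallel class -/

section Dense

variable {α : Type*} {M N : Matroid α} {A B F G R S X Y Z W : Set α} {e f : α}

/-- `S` meets every parallel class of `N`. -/
structure IsParallelDense (N : Matroid α) (S : Set α) : Prop where
  subset_ground : S ⊆ N.E
  exists_mem : ∀ x ∈ N.E, x ∉ N.loops → ∃ s ∈ S, s ∈ N.closure {x} ∧ x ∈ N.closure {s}

theorem IsParallelDense.exists_mem_flat (hS : IsParallelDense N S) (hF : N.IsFlat F) {x : α}
    (hx : x ∈ F) (hxl : x ∉ N.loops) : ∃ s ∈ F ∩ S, x ∈ N.closure {s} := by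
  obtain ⟨s, hs, hsx, hxs⟩ := hS.exists_mem x (hF.subset_ground hx) hxl
  exact ⟨s, ⟨closure_subset_flat hF (by simpa) hsx, hs⟩, hxs⟩

/-- A nonloop of F is parallel to an element of S, which again lies in F; loops lie in every
closure. So a flat is recovered from its trace on S. -/
theorem IsParallelDense.closure_inter (hS : IsParallelDense N S) (hF : N.IsFlat F) :
    N.closure (F ∩ S) = F := by
  refine (closure_subset_flat hF Set.inter_subset_left).antisymm fun x hx => ?_
  by_cases hxl : x ∈ N.loops
  · exact N.closure_subset_closure (Set.empty_subset _) hxl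
  · obtain ⟨s, hs, hxs⟩ := hS.exists_mem_flat hF hx hxl
    exact N.closure_subset_closure (by simpa using hs) hxs

theorem IsParallelDense.rk_inter (hS : IsParallelDense N S) (hF : N.IsFlat F) :
    rk N (F ∩ S) = rk N F := by
  rw [← rk_closure, hS.closure_inter hF]

theorem IsParallelDense.rk_eq (hS : IsParallelDense N S) : rk N S = rk N N.E := by
  rw [← hS.rk_inter N.ground_isFlat, Set.inter_eq_right.2 hS.subset_ground]

theorem IsParallelDense.restrict_flat (hS : IsParallelDense N S) (hF : N.IsFlat F) :
    IsParallelDense (N ↾ F) (F ∩ S) where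
  subset_ground := Set.inter_subset_left
  exists_mem x hx hxl := by
    have hx' : x ∈ F := hx
    rw [Matroid.restrict_loops_eq hF.subset_ground] at hxl
    obtain ⟨s, hs, hsx, hxs⟩ := hS.exists_mem x (hF.subset_ground hx') fun h => hxl ⟨h, hx'⟩
    have hsF : s ∈ F := closure_subset_flat hF (by simpa) hsx
    refine ⟨s, ⟨hsF, hs⟩, ?_, ?_⟩
    · rw [N.restrict_closure_eq (by simpa) hF.subset_ground]
      exact ⟨hsx, hsF⟩
    · rw [N.restrict_closure_eq (by simpa) hF.subset_ground]
      exact ⟨hxs, hx'⟩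

/-- Trace on S and closure in N are mutually inverse, rank-preserving maps between the two lattices
of flats. -/
theorem IsParallelDense.charPoly_restrict [N.Finite] [(N ↾ S).Finite]
    (hS : IsParallelDense N S) : charPoly (N ↾ S) = charPoly N := by
  refine charPoly_congr (· ∩ S) (fun G hG => isFlat_inter_restrict hS.subset_ground hG) ?_ ?_ ?_ ?_
  · intro G H hG hH
    refine ⟨fun h => ?_, fun h => Set.inter_subset_inter_left _ h⟩
    rw [← hS.closure_inter hG, ← hS.closure_inter hH]
    exact N.closure_subset_closure h
  · intro H hH
    exact ⟨N.closure H, N.isFlat_closure H, ((isFlat_restrict_iff hS.subset_ground).1 hH).2⟩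
  · intro G hG
    rw [rk_restrict N Set.inter_subset_right, hS.rk_inter hG]
  · rw [Matroid.restrict_ground_eq, rk_restrict N (subset_refl S), hS.rk_eq]

theorem IsParallelDense.inter_closure (hS : IsParallelDense N S) (hX : (N ↾ S).IsFlat X) :
    N.closure X ∩ S = X :=
  ((isFlat_restrict_iff hS.subset_ground).1 hX).2

theorem IsParallelDense.isModularFlat_inter [N.RankFinite] (hS : IsParallelDense N S)
    (hX : IsModularFlat N X) : IsModularFlat (N ↾ S) (X ∩ S) := by
  rw [isModularFlat_iff]
  refine ⟨isFlat_inter_restrict hS.subset_ground hX.isFlat, fun Y hY => ?_⟩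
  have hYS := ((isFlat_restrict_iff hS.subset_ground).1 hY).1
  have h := hX.rk_eq (N.isFlat_closure Y)
  have h1 : X ∩ S ∩ Y = (X ∩ N.closure Y) ∩ S := by
    conv_lhs => rw [← hS.inter_closure hY]
    ext; simp; tauto
  have h2 : rk N (X ∩ S ∪ Y) = rk N (X ∪ N.closure Y) :=
    rk_congr_closure (by
      rw [Matroid.closure_union_closure_right_eq, ← Matroid.closure_union_closure_left_eq,
        hS.closure_inter hX.isFlat])
  rw [rk_restrict N Set.inter_subset_right, rk_restrict N hYS,
    rk_restrict N (Set.inter_subset_right.trans hYS),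
    rk_restrict N (Set.union_subset Set.inter_subset_right hYS), hS.rk_inter hX.isFlat, h1,
    hS.rk_inter (isFlat_inter hX.isFlat (N.isFlat_closure Y)), h2, ← h, rk_closure]

theorem IsParallelDense.isModularFlat_closure [N.RankFinite] (hS : IsParallelDense N S)
    (hX : IsModularFlat (N ↾ S) X) : IsModularFlat N (N.closure X) := by
  rw [isModularFlat_iff]
  refine ⟨N.isFlat_closure X, fun Y hY => ?_⟩
  have hXS := ((isFlat_restrict_iff hS.subset_ground).1 hX.isFlat).1
  have h := hX.rk_eq (isFlat_inter_restrict hS.subset_ground hY)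
  rw [rk_restrict N hXS, rk_restrict N Set.inter_subset_right,
    rk_restrict N (Set.inter_subset_left.trans hXS),
    rk_restrict N (Set.union_subset hXS Set.inter_subset_right), hS.rk_inter hY] at h
  have h1 : X ∩ (Y ∩ S) = (N.closure X ∩ Y) ∩ S := by
    conv_lhs => rw [← hS.inter_closure hX.isFlat]
    ext; simp; tauto
  have h2 : rk N (X ∪ Y ∩ S) = rk N (N.closure X ∪ Y) :=
    rk_congr_closure (by
      rw [Matroid.closure_union_closure_left_eq, ← Matroid.closure_union_closure_right_eq,
        hS.closure_inter hY])
  rw [rk_closure, h, h1, h2, hS.rk_inter (isFlat_inter (N.isFlat_closure X) hY)]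

theorem IsParallelDense.isCoatomFlat_inter [N.RankFinite] (hS : IsParallelDense N S)
    (hX : IsCoatomFlat N X) : IsCoatomFlat (N ↾ S) (X ∩ S) := by
  have h := isCoatomFlat_iff.1 hX
  rw [isCoatomFlat_iff]
  refine ⟨isFlat_inter_restrict hS.subset_ground hX.isFlat, ?_⟩
  rw [rk_restrict N Set.inter_subset_right, hS.rk_inter hX.isFlat, h.2,
    Matroid.restrict_ground_eq, rk_restrict N subset_rfl, hS.rk_eq]

theorem IsParallelDense.isCoatomFlat_closure [N.RankFinite] (hS : IsParallelDense N S)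
    (hX : IsCoatomFlat (N ↾ S) X) : IsCoatomFlat N (N.closure X) := by
  have h := (isCoatomFlat_iff.1 hX).2
  have hXS := ((isFlat_restrict_iff hS.subset_ground).1 hX.isFlat).1
  rw [isCoatomFlat_iff]
  refine ⟨N.isFlat_closure X, ?_⟩
  rwa [rk_restrict N hXS, Matroid.restrict_ground_eq, rk_restrict N subset_rfl, hS.rk_eq,
    ← rk_closure] at h

/-- Enlarging a round restriction inside its closure keeps it round. -/
theorem IsRound.of_subset_closure (hZ : IsRound (M ↾ Z)) (hZW : Z ⊆ W) (hW : W ⊆ M.closure Z) :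
    IsRound (M ↾ W) := by
  have hWE := hW.trans (M.closure_subset_ground Z)
  have hZE := hZW.trans hWE
  -- A cover of W by flats restricts to one of Z; a flat containing Z contains its closure, hence W.
  have key : ∀ F, (M ↾ W).IsFlat F → (M ↾ Z).IsFlat (F ∩ Z) ∧ (F ∩ Z = Z → F = W) := by
    intro F hF
    rw [isFlat_restrict_iff hWE] at hF
    refine ⟨?_, fun h => hF.1.antisymm ?_⟩
    · have : F ∩ Z = M.closure F ∩ Z := by
        conv_lhs => rw [← hF.2]
        ext x; simp only [Set.mem_inter_iff]
        exact ⟨fun h => ⟨h.1.1, h.2⟩, fun h => ⟨⟨h.1, hZW h.2⟩, h.2⟩⟩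
      rw [this]
      exact isFlat_inter_restrict hZE (M.isFlat_closure F)
    · rw [← hF.2]
      exact Set.subset_inter (hW.trans (M.closure_subset_closure (Set.inter_eq_right.1 h))) subset_rfl
  intro F₁ F₂ h₁ h₂ h
  have hE : F₁ ∩ Z ∪ F₂ ∩ Z = Z := by
    rw [← Set.union_inter_distrib_right, h]
    exact Set.inter_eq_right.2 hZW
  exact (hZ _ _ (key F₁ h₁).1 (key F₂ h₂).1 hE).imp (key F₁ h₁).2 (key F₂ h₂).2

/-- If two flats cover S, their closures cover N: every nonloop is parallel to an element of S, and
loops lie in both closures. -/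
theorem IsParallelDense.isRound_restrict (hS : IsParallelDense N S) (hN : IsRound N) :
    IsRound (N ↾ S) := by
  intro F₁ F₂ h₁ h₂ h
  have key : N.closure F₁ ∪ N.closure F₂ = N.E := by
    refine (Set.union_subset (N.closure_subset_ground _) (N.closure_subset_ground _)).antisymm ?_
    intro x hx
    by_cases hxl : x ∈ N.loops
    · exact Or.inl (N.closure_subset_closure (Set.empty_subset _) hxl)
    · obtain ⟨s, hs, -, hxs⟩ := hS.exists_mem x hx hxl
      have hs' : s ∈ F₁ ∪ F₂ := h ▸ hs
      exact hs'.imp (fun h => N.closure_subset_closure (by simpa) hxs)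
        (fun h => N.closure_subset_closure (by simpa) hxs)
  have conv : ∀ F, (N ↾ S).IsFlat F → N.closure F = N.E → F = S := fun F hF hc => by
    rw [← hS.inter_closure hF, hc, Set.inter_eq_right.2 hS.subset_ground]
  exact (hN _ _ (N.isFlat_closure _) (N.isFlat_closure _) key).imp (conv F₁ h₁) (conv F₂ h₂)

/-! ### Modular extension up to loops and parallel elements -/

/-- Modularly extended matroids without the simplicity requirement. -/
inductive WeakModularlyExtended : Matroid α → Prop
  | loops (M : Matroid α) (hM : M.Finite) (h : M.E ⊆ M.loops) : WeakModularlyExtended M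
  | modularCoatom (M : Matroid α) (X : Set α) (hM : M.Finite) (hX : IsModularFlat M X)
      (hX' : IsCoatomFlat M X) (h : WeakModularlyExtended (M ↾ X)) : WeakModularlyExtended M
  | modularJoin (M : Matroid α) (E₁ E₂ : Set α) (hM : M.Finite) (hE : IsModularJoin M E₁ E₂)
      (hround : IsRound (M ↾ (E₁ ∩ E₂))) (h₁ : WeakModularlyExtended (M ↾ E₁))
      (h₂ : WeakModularlyExtended (M ↾ E₂)) : WeakModularlyExtended M

theorem ModularlyExtended.weak (h : ModularlyExtended M) : WeakModularlyExtended M := by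
  induction h with
  | empty => exact .loops _ ⟨by simp⟩ (by simp)
  | modularCoatom M X hM hX hX' _ ih => exact .modularCoatom M X hM.finite hX hX' ih
  | modularJoin M E₁ E₂ hM hE hr _ _ ih₁ ih₂ =>
    exact .modularJoin M E₁ E₂ hM.finite hE hr ih₁ ih₂

/-- Intersecting every flat of the construction with S gives a construction of the simple
restriction. -/
theorem WeakModularlyExtended.restrict_of_isSimple (h : WeakModularlyExtended N)
    (hS : IsParallelDense N S) (hsimple : IsSimple (N ↾ S)) : ModularlyExtended (N ↾ S) := by
  -- The induction hypothesis restricts first to F, the constructor first to S.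
  have aux : ∀ {N : Matroid α} {S F : Set α}, N.IsFlat F →
      (N ↾ F) ↾ (F ∩ S) = (N ↾ S) ↾ (F ∩ S) := fun {N S F} hF => by
    rw [N.restrict_restrict_eq Set.inter_subset_left,
      N.restrict_restrict_eq Set.inter_subset_right]
  induction h generalizing S with
  | loops N hN h =>
    have : S = ∅ := by
      have h1 := hsimple.loops_eq
      rw [Matroid.restrict_loops_eq hS.subset_ground,
        Set.inter_eq_right.2 (hS.subset_ground.trans h)] at h1
      exact h1
    rw [this, Matroid.restrict_empty]
    exact .empty
  | modularCoatom N X hN hX hX' _ ih =>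
    refine .modularCoatom _ (X ∩ S) hsimple (hS.isModularFlat_inter hX)
      (hS.isCoatomFlat_inter hX') ?_
    rw [← aux hX.isFlat]
    refine ih (hS.restrict_flat hX.isFlat) ?_
    rw [aux hX.isFlat]
    exact hsimple.restrict Set.inter_subset_right
  | modularJoin N E₁ E₂ hN hE hr _ _ ih₁ ih₂ =>
    have hf₁ := hE.modular_left.isFlat
    have hf₂ := hE.modular_right.isFlat
    have hne : ∀ F, N.IsFlat F → F ≠ N.E → F ∩ S ≠ S := fun F hF hFE h => hFE (by
      rw [← hS.closure_inter hF, h, ← hS.closure_inter N.ground_isFlat,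
        Set.inter_eq_right.2 hS.subset_ground])
    refine .modularJoin _ (E₁ ∩ S) (E₂ ∩ S) hsimple ⟨hS.isModularFlat_inter hE.modular_left,
      hS.isModularFlat_inter hE.modular_right, hne _ hf₁ hE.proper_left,
      hne _ hf₂ hE.proper_right, ?_⟩ ?_ ?_ ?_
    · rw [← Set.union_inter_distrib_right, hE.union_eq, Matroid.restrict_ground_eq,
        Set.inter_eq_right.2 hS.subset_ground]
    · rw [← Set.inter_inter_distrib_right, ← aux (isFlat_inter hf₁ hf₂)]
      exact (hS.restrict_flat (isFlat_inter hf₁ hf₂)).isRound_restrict hr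
    · rw [← aux hf₁]
      refine ih₁ (hS.restrict_flat hf₁) ?_
      rw [aux hf₁]
      exact hsimple.restrict Set.inter_subset_right
    · rw [← aux hf₂]
      refine ih₂ (hS.restrict_flat hf₂) ?_
      rw [aux hf₂]
      exact hsimple.restrict Set.inter_subset_right

/-- The reverse passage: every flat of the construction is replaced by its closure in N. -/
theorem WeakModularlyExtended.of_restrict (h : WeakModularlyExtended (N ↾ S)) (hN : N.Finite)
    (hS : IsParallelDense N S) : WeakModularlyExtended N := by
  generalize hNS : N ↾ S = M at h
  have aux : ∀ {N : Matroid α} {S X : Set α}, IsParallelDense N S → (N ↾ S).IsFlat X →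
      X ⊆ S ∧ IsParallelDense (N ↾ N.closure X) X ∧
        (N ↾ N.closure X) ↾ X = (N ↾ S) ↾ X := fun {N S X} hS hX => by
    have hXS := ((isFlat_restrict_iff hS.subset_ground).1 hX).1
    have h := hS.restrict_flat (N.isFlat_closure X)
    rw [hS.inter_closure hX] at h
    refine ⟨hXS, h, ?_⟩
    rw [N.restrict_restrict_eq hXS,
      N.restrict_restrict_eq (show X ⊆ N.closure X from h.subset_ground)]
  induction h generalizing N S with
  | loops M hM h =>
    subst hNS
    refine .loops _ hN ?_
    rw [Matroid.restrict_loops_eq hS.subset_ground, Matroid.restrict_ground_eq] at h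
    rw [← hS.closure_inter N.ground_isFlat]
    exact closure_subset_flat (N.isFlat_closure ∅)
      (Set.inter_subset_right.trans (h.trans Set.inter_subset_left))
  | modularCoatom M X hM hX hX' _ ih =>
    subst hNS
    obtain ⟨hXS, hd, heq⟩ := aux hS hX.isFlat
    refine .modularCoatom _ (N.closure X) hN (hS.isModularFlat_closure hX)
      (hS.isCoatomFlat_closure hX') (ih ?_ hd heq)
    exact Matroid.restrict_finite (N.ground_finite.subset (N.closure_subset_ground X))
  | modularJoin M E₁ E₂ hM hE hr _ _ ih₁ ih₂ =>
    subst hNS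
    have hf₁ := hE.modular_left.isFlat
    have hf₂ := hE.modular_right.isFlat
    obtain ⟨hS₁, hd₁, heq₁⟩ := aux hS hf₁
    obtain ⟨hS₂, hd₂, heq₂⟩ := aux hS hf₂
    have hfin : ∀ X, (N ↾ N.closure X).Finite := fun X =>
      Matroid.restrict_finite (N.ground_finite.subset (N.closure_subset_ground X))
    have hne : ∀ F, (N ↾ S).IsFlat F → F ≠ S → N.closure F ≠ N.E := fun F hF hFS h => hFS (by
      rw [← hS.inter_closure hF, h, Set.inter_eq_right.2 hS.subset_ground])
    refine .modularJoin _ (N.closure E₁) (N.closure E₂) hN ⟨hS.isModularFlat_closure hE.modular_left,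
      hS.isModularFlat_closure hE.modular_right, hne _ hf₁ hE.proper_left,
      hne _ hf₂ hE.proper_right, ?_⟩ ?_ (ih₁ (hfin _) hd₁ heq₁) (ih₂ (hfin _) hd₂ heq₂)
    · refine (Set.union_subset (N.closure_subset_ground _) (N.closure_subset_ground _)).antisymm ?_
      intro x hx
      by_cases hxl : x ∈ N.loops
      · exact Or.inl (N.closure_subset_closure (Set.empty_subset _) hxl)
      · obtain ⟨s, hs, -, hxs⟩ := hS.exists_mem x hx hxl
        have hs' : s ∈ E₁ ∪ E₂ := by rw [hE.union_eq]; exact hs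
        exact hs'.imp (fun h => N.closure_subset_closure (by simpa) hxs)
          (fun h => N.closure_subset_closure (by simpa) hxs)
    · rw [N.restrict_restrict_eq (Set.inter_subset_left.trans hS₁)] at hr
      -- The closures of the two sides meet in a flat spanned by E₁ ∩ E₂, so roundness survives the
      -- enlargement.
      refine hr.of_subset_closure (Set.inter_subset_inter hd₁.subset_ground hd₂.subset_ground) ?_
      rw [← hS.closure_inter (isFlat_inter (N.isFlat_closure E₁) (N.isFlat_closure E₂)),
        Set.inter_inter_distrib_right, hS.inter_closure hf₁, hS.inter_closure hf₂]

/-- Parallel elements have equal closures, hence the same chosen representative. So every class is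
met, and two parallel chosen elements coincide. -/
theorem si_spec (N : Matroid α) : ∃ S, si N = N ↾ S ∧ IsParallelDense N S ∧
    (N.Finite → IsSimple (N ↾ S)) := by
  have some_eq : ∀ {A B : Set α} (hA : A.Nonempty) (hB : B.Nonempty), A = B →
      hA.some = hB.some := by
    rintro A _ hA hB rfl
    rfl
  have hmem : ∀ {e}, (∃ h : (N.closure {e} \ N.loops).Nonempty, e = h.some) →
      e ∈ N.closure {e} \ N.loops := by
    rintro e ⟨h, he⟩
    have := h.some_mem
    rwa [← he] at this
  have hE : {e | ∃ h : (N.closure {e} \ N.loops).Nonempty, e = h.some} ⊆ N.E := fun e he =>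
    N.closure_subset_ground _ (hmem he).1
  have hnl : ∀ {e}, e ∈ N.E → e ∉ N.loops → N.IsNonloop e := fun he h =>
    Matroid.isNonloop_iff_mem_compl_loops.2 ⟨he, h⟩
  refine ⟨_, rfl, ⟨hE, fun x hx hxl => ?_⟩, fun hN => ⟨?_, ?_⟩⟩
  · have h : (N.closure {x} \ N.loops).Nonempty := ⟨x, N.mem_closure_self x hx, hxl⟩
    have hs := h.some_mem
    have hcl : N.closure {h.some} = N.closure {x} :=
      (hnl (N.closure_subset_ground _ hs.1) hs.2).closure_eq_of_mem_closure hs.1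
    have h' : (N.closure {h.some} \ N.loops).Nonempty := by rwa [hcl]
    refine ⟨h.some, ⟨h', ?_⟩, hs.1, ?_⟩
    · exact some_eq h h' (by rw [hcl])
    · rw [hcl]
      exact N.mem_closure_self x hx
  · exact Matroid.restrict_finite (N.ground_finite.subset hE)
  · intro e he f hf
    rw [Matroid.restrict_indep_iff]
    refine ⟨?_, Set.pair_subset he hf⟩
    have hne := hnl (hE he) (hmem he).2
    have hnf := hnl (hE hf) (hmem hf).2
    by_cases hef : e = f
    · simpa [hef] using hnf
    rw [← hnf.indep.notMem_closure_iff_of_notMem (by simpa) (hE he)]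
    intro hc
    have hcl := hne.closure_eq_of_mem_closure hc
    obtain ⟨h1, he1⟩ := he
    obtain ⟨h2, hf2⟩ := hf
    apply hef
    rw [he1, hf2]
    exact some_eq h1 h2 (by rw [hcl])

end Dense

/-! ### Contracting an element: modular flats, cofactors, roundness, and the induction -/

section Main

variable {α : Type*} {M N : Matroid α} {A B F G R S X Y Z W : Set α} {e f p : α}

theorem charPoly_eq_of_eq [M.Finite] [N.Finite] (h : M = N) : charPoly M = charPoly N := by
  subst h
  rfl

/-- Projection from e onto Y: the line through p and e has rank 2 but raises the rank of Y by at
most 1, so by modularity it meets Y in positive rank. -/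
theorem IsSimple.exists_mem_closure_pair [M.RankFinite] (hM : IsSimple M)
    (hY : IsModularFlat M Y) (he : e ∈ M.E) (heY : e ∉ Y) (hp : p ∈ M.closure (insert e Y))
    (hpe : p ≠ e) : ∃ y ∈ Y, y ∈ M.closure {p, e} ∧ p ∈ M.closure {y, e} := by
  have hpE := M.closure_subset_ground _ hp
  have hYE := hY.isFlat.subset_ground
  have h1 := hY.rk_eq (M.isFlat_closure {p, e})
  have h2 : rk M (Y ∪ M.closure {p, e}) ≤ rk M (insert e Y) := by
    rw [← rk_closure M (insert e Y)]
    have hYC : Y ⊆ M.closure (insert e Y) :=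
      M.subset_closure_of_subset' (Set.subset_insert _ _) hYE
    refine rk_mono M (Set.union_subset hYC (closure_subset_flat (M.isFlat_closure _) ?_))
    exact Set.pair_subset hp (M.mem_closure_of_mem' (Set.mem_insert _ _) he)
  rw [rk_insert_of_flat hY.isFlat he heY] at h2
  rw [rk_closure, hM.rk_pair hpE he hpe] at h1
  obtain ⟨y, hy, -⟩ := exists_isNonloop_of_rk_pos (M := M) (A := Y ∩ M.closure {p, e})
    (Set.inter_subset_left.trans hYE) (by omega)
  refine ⟨y, hy.1, hy.2, Matroid.mem_closure_insert ?_ hy.2⟩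
  rw [(hM.isFlat_singleton he).closure]
  rintro rfl
  exact heY hy.1

/-- No subset of Y spans e, so adjoining e never destroys independence. -/
theorem contractElem_restrict_of_notMem_flat (hY : M.IsFlat Y) (he : M.IsNonloop e) (heY : e ∉ Y) :
    (M ／ {e}) ↾ Y = M ↾ Y := by
  refine Matroid.ext_indep rfl fun I hI => ?_
  have hI' : I ⊆ Y := hI
  rw [Matroid.restrict_indep_iff, Matroid.restrict_indep_iff, he.contractElem_indep_iff,
    Matroid.insert_indep_iff]
  have : e ∉ M.closure I := fun h => heY (closure_subset_flat hY hI' h)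
  have := fun h => heY (hI' h)
  have := he.mem_ground
  simp only [Set.mem_sdiff]
  tauto

/-- A modular flat meets every parallel class of the contraction by an outside element
within its span. -/
theorem IsModularFlat.isParallelDense_contractElem [M.RankFinite] (hM : IsSimple M)
    (hY : IsModularFlat M Y) (he : e ∈ M.E) (heY : e ∉ Y) :
    IsParallelDense ((M ／ {e}) ↾ (M.closure (insert e Y) \ {e})) Y := by
  have hYE := hY.isFlat.subset_ground
  have hYC : Y ⊆ M.closure (insert e Y) \ {e} := fun y hy =>
    ⟨M.subset_closure_of_subset' (Set.subset_insert _ _) hYE hy, by rintro rfl; exact heY hy⟩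
  have hCE : M.closure (insert e Y) \ {e} ⊆ (M ／ {e}).E :=
    Set.sdiff_subset_sdiff_left (M.closure_subset_ground _)
  refine ⟨hYC, fun x hx _ => ?_⟩
  obtain ⟨hx1, hx2⟩ : x ∈ M.closure (insert e Y) \ {e} := hx
  obtain ⟨y, hy, hyx, hxy⟩ := hM.exists_mem_closure_pair hY he heY hx1 hx2
  refine ⟨y, hy, ?_, ?_⟩
  · rw [Matroid.restrict_closure_eq _ (by simpa using ⟨hx1, hx2⟩) hCE,
      Matroid.contract_closure_eq]
    exact ⟨⟨hyx, (hYC hy).2⟩, hYC hy⟩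
  · rw [Matroid.restrict_closure_eq _ (by simpa using hYC hy) hCE, Matroid.contract_closure_eq]
    exact ⟨⟨hxy, hx2⟩, hx1, hx2⟩

theorem isFlat_sdiff_contractElem (hY : M.IsFlat Y) (he : e ∈ Y) :
    (M ／ {e}).IsFlat (Y \ {e}) := by
  rw [isFlat_contractElem_iff (hY.subset_ground he)]
  simpa [Set.insert_eq_of_mem he] using hY

theorem IsModularFlat.contractElem_of_mem [M.RankFinite] (hY : IsModularFlat M Y)
    (he : M.IsNonloop e) (heY : e ∈ Y) : IsModularFlat (M ／ {e}) (Y \ {e}) := by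
  rw [isModularFlat_iff]
  refine ⟨isFlat_sdiff_contractElem hY.isFlat heY, fun F hF => ?_⟩
  rw [isFlat_contractElem_iff he.mem_ground] at hF
  have h := hY.rk_eq hF.2
  have h1 := rk_contractElem he (Y \ {e})
  have h2 := rk_contractElem he F
  have h3 := rk_contractElem he (Y \ {e} ∩ F)
  have h4 := rk_contractElem he (Y \ {e} ∪ F)
  have e1 : insert e (Y \ {e}) = Y := by simp [heY]
  have e3 : insert e (Y \ {e} ∩ F) = Y ∩ insert e F := by
    rw [Set.insert_inter_distrib, e1]
  have e4 : insert e (Y \ {e} ∪ F) = Y ∪ insert e F := by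
    rw [← Set.insert_union, e1, Set.union_insert, Set.insert_eq_of_mem (Set.mem_union_left F heY)]
  rw [e1] at h1
  rw [e3] at h3
  rw [e4] at h4
  omega

/-- Put K = cl(X + e). For a flat F' through e, K ∩ F' contains X ∩ F' and also e ∉ X, so its rank
is at least one larger. With modularity of X this gives one inequality for K; submodularity gives
the other. -/
theorem IsModularFlat.contractElem_of_notMem [M.RankFinite] (hX : IsModularFlat M X)
    (he : M.IsNonloop e) (heX : e ∉ X) :
    IsModularFlat (M ／ {e}) (M.closure (insert e X) \ {e}) := by
  have heE := he.mem_ground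
  have heC : e ∈ M.closure (insert e X) := M.mem_closure_of_mem' (Set.mem_insert _ _) heE
  have hXC : X ⊆ M.closure (insert e X) :=
    M.subset_closure_of_subset' (Set.subset_insert _ _) hX.isFlat.subset_ground
  rw [isModularFlat_iff]
  refine ⟨isFlat_sdiff_contractElem (M.isFlat_closure _) heC, fun F hF => ?_⟩
  rw [isFlat_contractElem_iff heE] at hF
  set K := M.closure (insert e X) with hK
  have h1 := rk_contractElem he (K \ {e})
  have h2 := rk_contractElem he F
  have h3 := rk_contractElem he (K \ {e} ∩ F)
  have h4 := rk_contractElem he (K \ {e} ∪ F)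
  have e1 : insert e (K \ {e}) = K := by simp [heC]
  have e3 : insert e (K \ {e} ∩ F) = K ∩ insert e F := by
    rw [Set.insert_inter_distrib, e1]
  have e4 : insert e (K \ {e} ∪ F) = K ∪ insert e F := by
    rw [← Set.insert_union, e1, Set.union_insert, Set.insert_eq_of_mem (Set.mem_union_left F heC)]
  rw [e1] at h1
  rw [e3] at h3
  rw [e4] at h4
  have h := hX.rk_eq hF.2
  have hrK : rk M K = rk M X + 1 := by rw [hK, rk_closure, rk_insert_of_flat hX.isFlat heE heX]
  have hKF : rk M (K ∪ insert e F) = rk M (X ∪ insert e F) := by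
    rw [hK, rk_union_closure_left]
    rw [Set.insert_union, Set.union_insert, Set.insert_idem]
  have hlow : rk M (X ∩ insert e F) + 1 ≤ rk M (K ∩ insert e F) := by
    rw [← rk_insert_of_flat (isFlat_inter hX.isFlat hF.2) heE fun h => heX h.1]
    exact rk_mono M (Set.insert_subset ⟨heC, Set.mem_insert _ _⟩
      (Set.inter_subset_inter_left _ hXC))
  have hsub := rk_submod M K (insert e F)
  omega

/-- Contracting an element of `Y` outside a complementary flat `X` does not change the
cofactor of the modular flat `Y`. -/
theorem complPoly_contractElem [M.Finite] (hM : IsSimple M) (hY : IsModularFlat M Y)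
    (hX : M.IsFlat X) (hXY : X ∪ Y = M.E) (heY : e ∈ Y) (heX : e ∉ X) :
    complPoly (M ／ {e}) (Y \ {e}) = complPoly M Y := by
  classical
  have heE : e ∈ M.E := hY.isFlat.subset_ground heY
  have he := hM.isNonloop heE
  have hl : (M ／ {e}).loops = ∅ := by
    rw [Matroid.contract_loops_eq, (hM.isFlat_singleton heE).closure, Set.sdiff_self]
  -- The two cofactors are sums over the same flats. The forward direction amounts to F + e being
  -- closed.
  have hflat : ∀ F, M.IsFlat F ∧ F ∩ Y = ∅ ↔
      (M ／ {e}).IsFlat F ∧ F ∩ (Y \ {e}) = ∅ := by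
    intro F
    rw [isFlat_contractElem_iff heE]
    constructor
    · rintro ⟨hF, hFY⟩
      have heF : e ∉ F := fun h => Set.notMem_empty e (hFY ▸ ⟨h, heY⟩)
      have hFX : F ⊆ X := fun x hx => by
        have : x ∈ X ∪ Y := hXY ▸ hF.subset_ground hx
        exact this.resolve_right fun h => Set.notMem_empty x (hFY ▸ ⟨hx, h⟩)
      refine ⟨⟨heF, ?_⟩, by rw [← Set.subset_empty_iff, ← hFY]; gcongr; exact Set.sdiff_subset⟩
      set K := M.closure (insert e F) with hK
      have hKf : M.IsFlat K := M.isFlat_closure _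
      have heK : e ∈ K := M.mem_closure_of_mem' (Set.mem_insert _ _) heE
      have hFK : F ⊆ K := M.subset_closure_of_subset' (Set.subset_insert _ _) hF.subset_ground
      have hrK : rk M K = rk M F + 1 := by rw [hK, rk_closure, rk_insert_of_flat hF heE heF]
      -- Since X ∪ Y = E, it suffices to find the traces of K = cl(F + e). Its trace on X omits e,
      -- so has rank at most r(F) and equals F; modularity of Y forces its trace on Y to be {e}.
      have hKX : F = K ∩ X := by
        refine eq_of_rk_le hF (Set.subset_inter hFK hFX)
          (Set.inter_subset_right.trans hX.subset_ground) ?_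
        have := rk_lt_of_notMem (isFlat_inter hKf hX) Set.inter_subset_left hKf.subset_ground
          heK fun h => heX h.2
        omega
      have hKY : {e} = K ∩ Y := by
        refine eq_of_rk_le (hM.isFlat_singleton heE) (by simp [heK, heY])
          (Set.inter_subset_right.trans hY.isFlat.subset_ground) ?_
        rw [rk_singleton he]
        have h1 := hY.rk_eq hKf
        have h2 := rk_union_add_of_inter_eq_loops hY hF (by rw [hFY, hM.loops_eq])
        have h3 := rk_mono M (Set.union_subset_union_right Y hFK)
        rw [Set.inter_comm] at h1
        omega
      have : insert e F = K := by
        refine (Set.insert_subset heK hFK).antisymm fun x hx => ?_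
        have hx' : x ∈ X ∪ Y := hXY ▸ hKf.subset_ground hx
        rcases hx' with h | h
        · right
          rw [hKX]
          exact ⟨hx, h⟩
        · left
          have : x ∈ ({e} : Set α) := hKY ▸ ⟨hx, h⟩
          exact this
      rwa [this]
    · rintro ⟨⟨heF, hF⟩, hFY⟩
      have hFY' : F ∩ Y = ∅ := by
        refine Set.eq_empty_of_forall_notMem fun x hx => ?_
        refine Set.notMem_empty x (hFY ▸ ⟨hx.1, hx.2, ?_⟩)
        rintro rfl
        exact heF hx.1
      refine ⟨?_, hFY'⟩
      -- Conversely, F avoids Y and so lies in X, while e does not: F is an intersection of two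
      -- flats.
      have : F = insert e F ∩ X := by
        ext x
        constructor
        · intro hx
          have hx' : x ∈ X ∪ Y := hXY ▸ hF.subset_ground (Or.inr hx)
          exact ⟨Or.inr hx, hx'.resolve_right fun h => Set.notMem_empty x (hFY' ▸ ⟨hx, h⟩)⟩
        · rintro ⟨rfl | hx, hxX⟩
          · exact absurd hxX heX
          · exact hx
      rw [this]
      exact isFlat_inter hF hX
  rw [complPoly, complPoly, hl, hM.loops_eq]
  have hidx : (flats (M ／ {e})).filter (fun F => F ∩ (Y \ {e}) = ∅) =
      (flats M).filter (fun F => F ∩ Y = ∅) := by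
    ext F
    simp only [Finset.mem_filter, mem_flats, hflat]
  rw [hidx]
  refine Finset.sum_congr rfl fun F hF => ?_
  rw [Finset.mem_filter, mem_flats] at hF
  have hmob : mob (M ／ {e}) F = mob M F := by
    refine mob_congr_of_forall_subset hF.1 fun G hGF => ?_
    have hGY : G ∩ Y = ∅ := by rw [← Set.subset_empty_iff, ← hF.2]; gcongr
    have hGY' : G ∩ (Y \ {e}) = ∅ := by
      rw [← Set.subset_empty_iff, ← hGY]; gcongr; exact Set.sdiff_subset
    have := hflat G
    tauto
  have h1 := rk_contractElem he (M ／ {e}).E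
  have h2 := rk_contractElem he (Y \ {e})
  have h3 := rk_contractElem he F
  rw [Matroid.contract_ground, Set.insert_sdiff_singleton, Set.insert_eq_of_mem heE] at h1
  rw [Set.insert_sdiff_singleton, Set.insert_eq_of_mem heY] at h2
  rw [rk_insert_of_flat hF.1 heE fun h => Set.notMem_empty e (hF.2 ▸ ⟨h, heY⟩)] at h3
  rw [hmob, Matroid.contract_ground]
  congr 2
  -- Contraction lowers the ranks of M and Y by one and keeps that of F, so the exponent is
  -- unchanged.
  omega

/-- Both characteristic polynomials factor over Y and its contraction with the same cofactor, so
divisibility is inherited from Y. -/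
theorem charPoly_contractElem_dvd [M.Finite] [(M ↾ Y).Finite] (hM : IsSimple M)
    (hY : IsModularFlat M Y) (hX : M.IsFlat X) (hXY : X ∪ Y = M.E) (heY : e ∈ Y) (heX : e ∉ X)
    (h : charPoly ((M ↾ Y) ／ {e}) ∣ charPoly (M ↾ Y)) :
    charPoly (M ／ {e}) ∣ charPoly M := by
  have heE : e ∈ M.E := hY.isFlat.subset_ground heY
  have heq := M.restrict_contract_eq_contract_restrict (C := {e}) (R := Y) (by simpa)
  have : ((M ／ {e}) ↾ (Y \ {e})).Finite := heq ▸ inferInstance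
  rw [charPoly_eq_mul hY, charPoly_eq_mul (hY.contractElem_of_mem (hM.isNonloop heE) heY),
    complPoly_contractElem hM hY hX hXY heY heX, ← charPoly_eq_of_eq heq]
  exact mul_dvd_mul_right h _

/-- A complement of a modular coatom that is round meets the coatom in a round flat. -/
theorem IsRound.inter_modularCoatom [M.RankFinite] (hM : IsSimple M) (hX : M.IsFlat X)
    (hround : IsRound (M ↾ X)) (hY : IsModularFlat M Y) (hY' : IsCoatomFlat M Y)
    (hXY : ¬ X ⊆ Y) : IsRound (M ↾ (X ∩ Y)) := by
  obtain ⟨e, heX, heY⟩ := Set.not_subset.1 hXY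
  have heE := hX.subset_ground heX
  have hXYf := isFlat_inter hX hY.isFlat
  intro F₁ F₂ h₁ h₂ h
  rw [isFlat_restrict_flat_iff hXYf] at h₁ h₂
  rw [Matroid.restrict_ground_eq] at h ⊢
  have hspan : M.closure (insert e Y) = M.E := by
    rw [← M.closure_ground]
    refine closure_eq_of_rk_le (Set.insert_subset heE hY.isFlat.subset_ground) ?_
    rw [rk_insert_of_flat hY.isFlat heE heY, (isCoatomFlat_iff.1 hY').2]
  have hGX : ∀ F, F ⊆ X ∩ Y → M.closure (insert e F) ⊆ X := fun F hF =>
    closure_subset_flat hX (Set.insert_subset heX (hF.trans Set.inter_subset_left))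
  -- A cover of X ∩ Y is coned to a cover of X with apex e: projecting p ∈ X from e onto Y lands in
  -- X ∩ Y, hence in F₁ or F₂.
  have hcover : M.closure (insert e F₁) ∪ M.closure (insert e F₂) = X := by
    refine (Set.union_subset (hGX _ h₁.2) (hGX _ h₂.2)).antisymm fun p hp => ?_
    have hpE := hX.subset_ground hp
    by_cases hpe : p = e
    · exact Or.inl (M.mem_closure_of_mem' (by simp [hpe]) hpE)
    obtain ⟨y, hy, hyp, hpy⟩ := hM.exists_mem_closure_pair hY heE heY (hspan ▸ hpE) hpe
    have hyX : y ∈ X := closure_subset_flat hX (Set.pair_subset hp heX) hyp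
    have hy' : y ∈ F₁ ∪ F₂ := h ▸ ⟨hyX, hy⟩
    refine hy'.imp (fun hy => ?_) (fun hy => ?_) <;>
    · refine M.closure_subset_closure ?_ hpy
      rw [Set.pair_comm]
      exact Set.insert_subset_insert (by simpa)
  have hfin : ∀ F, M.IsFlat F ∧ F ⊆ X ∩ Y → M.closure (insert e F) = X → F = X ∩ Y := by
    rintro F ⟨hF, hFXY⟩ hFX
    refine eq_of_rk_le hF hFXY hXYf.subset_ground ?_
    have h1 := rk_insert_le M e F
    rw [← rk_closure, hFX] at h1
    have h2 := rk_lt_of_notMem hXYf Set.inter_subset_left hX.subset_ground heX fun h => heY h.2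
    omega
  have hflat : ∀ F, F ⊆ X ∩ Y → (M ↾ X).IsFlat (M.closure (insert e F)) := fun F hF =>
    (isFlat_restrict_flat_iff hX).2 ⟨M.isFlat_closure _, hGX F hF⟩
  exact (hround _ _ (hflat _ h₁.2) (hflat _ h₂.2) hcover).imp (hfin F₁ h₁) (hfin F₂ h₂)

/-- Extending a good contraction of one side of a modular join to the whole matroid. -/
theorem weakModularlyExtended_contractElem_of_join {E₁ E₂ : Set α} (hM : IsSimple M)
    (hE : IsModularJoin M E₁ E₂) (hround : IsRound (M ↾ (E₁ ∩ E₂)))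
    (h₁ : ModularlyExtended (M ↾ E₁)) (he₂ : e ∈ E₂) (he₁ : e ∉ E₁)
    (h₂ : WeakModularlyExtended ((M ↾ E₂) ／ {e})) : WeakModularlyExtended (M ／ {e}) := by
  have := hM.finite
  have hf₁ := hE.modular_left.isFlat
  have hf₂ := hE.modular_right.isFlat
  have heE := hf₂.subset_ground he₂
  have he := hM.isNonloop heE
  have heC : e ∈ M.closure (insert e E₁) := M.mem_closure_of_mem' (Set.mem_insert _ _) heE
  have hd := hE.modular_left.isParallelDense_contractElem hM heE he₁
  have hEK : E₁ ⊆ M.closure (insert e E₁) \ {e} := hd.subset_ground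
  have hKE : M.closure (insert e E₁) \ {e} ⊆ (M ／ {e}).E :=
    Set.sdiff_subset_sdiff_left (M.closure_subset_ground _)
  have hW₁ : WeakModularlyExtended ((M ／ {e}) ↾ (M.closure (insert e E₁) \ {e})) := by
    refine WeakModularlyExtended.of_restrict (S := E₁) ?_
      (Matroid.restrict_finite ((M ／ {e}).ground_finite.subset hKE)) hd
    rw [Matroid.restrict_restrict_eq _ hEK, contractElem_restrict_of_notMem_flat hf₁ he he₁]
    exact h₁.weak
  -- If E₁ and e span M, the contracted left side is not proper and there is no join; but then M/e
  -- is already parallel to M|E₁.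
  by_cases hK : M.closure (insert e E₁) \ {e} = (M ／ {e}).E
  · rwa [hK, Matroid.restrict_ground_eq_self] at hW₁
  refine .modularJoin _ (M.closure (insert e E₁) \ {e}) (E₂ \ {e}) inferInstance
    ⟨hE.modular_left.contractElem_of_notMem he he₁, hE.modular_right.contractElem_of_mem he he₂,
      hK, ?_, ?_⟩ ?_ hW₁ ?_
  · intro h
    apply hE.proper_right
    rw [Matroid.contract_ground] at h
    rw [← Set.insert_eq_of_mem he₂, ← Set.insert_sdiff_singleton, h, Set.insert_sdiff_singleton,
      Set.insert_eq_of_mem heE]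
  · rw [← Set.union_sdiff_distrib, Matroid.contract_ground]
    congr 1
    refine (Set.union_subset (M.closure_subset_ground _) hf₂.subset_ground).antisymm ?_
    rw [← hE.union_eq]
    exact Set.union_subset_union_left _ (hEK.trans Set.sdiff_subset)
  · have hdiff : M.closure (insert e E₁) \ {e} ∩ (E₂ \ {e}) =
        (M.closure (insert e E₁) ∩ E₂) \ {e} := by
      ext x
      simp only [Set.mem_inter_iff, Set.mem_sdiff]
      tauto
    rw [hdiff]
    have hZf := isFlat_inter hf₁ hf₂
    have heZ : e ∉ E₁ ∩ E₂ := fun h => he₁ h.1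
    rw [← contractElem_restrict_of_notMem_flat hZf he heZ] at hround
    refine hround.of_subset_closure ?_ ?_
    · exact fun x hx => ⟨⟨(hEK hx.1).1, hx.2⟩, (hEK hx.1).2⟩
    · rw [Matroid.contract_closure_eq, Set.union_singleton]
      refine Set.sdiff_subset_sdiff_left ?_
      have hCf : M.IsFlat (M.closure (insert e E₁) ∩ E₂) := isFlat_inter (M.isFlat_closure _) hf₂
      have hsub : insert e (E₁ ∩ E₂) ⊆ M.closure (insert e E₁) ∩ E₂ :=
        Set.insert_subset ⟨heC, he₂⟩
          (Set.inter_subset_inter_left _ (hEK.trans Set.sdiff_subset))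
      rw [closure_eq_of_rk_le hsub]
      · exact M.subset_closure _ hCf.subset_ground
      · rw [rk_insert_of_flat hZf heE heZ]
        -- Comparing modularity of E₂ against cl(E₁ + e) and against E₁ bounds the rank of cl(E₁ +
        -- e) ∩ E₂ by r(E₁ ∩ E₂) + 1. So E₁ ∩ E₂ spans the new intersection in M/e, which makes it
        -- round.
        have a1 := hE.modular_right.rk_eq (M.isFlat_closure (insert e E₁))
        have a2 := hE.modular_right.rk_eq hf₁
        rw [Set.union_comm E₂ E₁, hE.union_eq, Set.inter_comm] at a2
        rw [Set.inter_comm, rk_closure, rk_insert_of_flat hf₁ heE he₁] at a1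
        have a3 : rk M M.E ≤ rk M (E₂ ∪ M.closure (insert e E₁)) := by
          refine rk_mono M ?_
          rw [← hE.union_eq, Set.union_comm]
          exact Set.union_subset_union_right _ (hEK.trans Set.sdiff_subset)
        omega
  · rwa [← M.restrict_contract_eq_contract_restrict (by simpa)]

/-- Outside every proper round flat of a modularly extended matroid there is a divisional atom
whose contraction is again modularly extended, up to simplification. -/
theorem ModularlyExtended.exists_divisional (h : ModularlyExtended M) :
    ∀ [M.Finite] {X : Set α}, M.IsFlat X → X ≠ M.E → IsRound (M ↾ X) →
    ∃ e ∈ M.E, e ∉ X ∧ charPoly (M ／ {e}) ∣ charPoly M ∧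
      WeakModularlyExtended (M ／ {e}) := by
  -- X stays quantified: the hypothesis is applied to X ∩ Y for a coatom and to E₁ ∩ E₂ for a join.
  induction h with
  | empty =>
    intro _ X hX hne _
    exact absurd (Set.subset_empty_iff.1 hX.subset_ground) hne
  | modularCoatom M Y hM hY hY' h ih =>
    intro _ X hX hne hround
    have hYE := hY.isFlat.subset_ground
    have hfinY : (M ↾ Y).Finite := Matroid.restrict_finite (M.ground_finite.subset hYE)
    -- When X and Y cover, e is sought in Y outside X, where contraction preserves the cofactor of
    -- Y.
    by_cases hXY : X ∪ Y = M.E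
    · have hYX : ¬ Y ⊆ X := fun h => hne (by rw [← hXY, Set.union_eq_left.2 h])
      have hXY' : ¬ X ⊆ Y := fun h => by
        rw [Set.union_eq_right.2 h] at hXY
        have := (isCoatomFlat_iff.1 hY').2
        rw [hXY] at this
        omega
      obtain ⟨e, heY, heX, hdvd, hW⟩ := ih
        ((isFlat_restrict_flat_iff hY.isFlat).2
          ⟨isFlat_inter hX hY.isFlat, Set.inter_subset_right⟩)
        (fun h => hYX (by rw [Matroid.restrict_ground_eq] at h; exact Set.inter_eq_right.1 h))
        (by
          rw [M.restrict_restrict_eq Set.inter_subset_right]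
          exact hround.inter_modularCoatom hM hX hY hY' hXY')
      rw [Matroid.restrict_ground_eq] at heY
      have heX' : e ∉ X := fun h => heX ⟨h, heY⟩
      have heE := hYE heY
      have he := hM.isNonloop heE
      refine ⟨e, heE, heX', charPoly_contractElem_dvd hM hY hX hXY heY heX' hdvd, ?_⟩
      refine .modularCoatom _ (Y \ {e}) inferInstance (hY.contractElem_of_mem he heY) ?_ ?_
      · rw [isCoatomFlat_iff]
        refine ⟨isFlat_sdiff_contractElem hY.isFlat heY, ?_⟩
        have h1 := rk_contractElem he (M ／ {e}).E
        have h2 := rk_contractElem he (Y \ {e})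
        rw [Matroid.contract_ground, Set.insert_sdiff_singleton, Set.insert_eq_of_mem heE] at h1
        rw [Set.insert_sdiff_singleton, Set.insert_eq_of_mem heY] at h2
        have h3 := (isCoatomFlat_iff.1 hY').2
        rw [Matroid.contract_ground]
        omega
      · rwa [← M.restrict_contract_eq_contract_restrict (by simpa)]
    -- Any e outside both flats works: Y meets every parallel class of M/e.
    · obtain ⟨e, heE, heXY⟩ := Set.exists_of_ssubset
        ((Set.union_subset hX.subset_ground hYE).ssubset_of_ne hXY)
      have heX : e ∉ X := fun h => heXY (Or.inl h)
      have heY : e ∉ Y := fun h => heXY (Or.inr h)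
      have he := hM.isNonloop heE
      have hspan : M.closure (insert e Y) = M.E := by
        rw [← M.closure_ground]
        refine closure_eq_of_rk_le (Set.insert_subset heE hYE) ?_
        rw [rk_insert_of_flat hY.isFlat heE heY, (isCoatomFlat_iff.1 hY').2]
      have hd := hY.isParallelDense_contractElem hM heE heY
      rw [hspan, ← Matroid.contract_ground, Matroid.restrict_ground_eq_self] at hd
      have heq := contractElem_restrict_of_notMem_flat hY.isFlat he heY
      have hfin' : ((M ／ {e}) ↾ Y).Finite := heq ▸ hfinY
      refine ⟨e, heE, heX, ?_, ?_⟩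
      · rw [← hd.charPoly_restrict, charPoly_eq_of_eq heq, charPoly_eq_mul hY]
        exact dvd_mul_right _ _
      · refine WeakModularlyExtended.of_restrict (S := Y) ?_ inferInstance hd
        rw [heq]
        exact h.weak
  | modularJoin M E₁ E₂ hM hE hr h₁ h₂ ih₁ ih₂ =>
    intro _ X hX hne hround
    have hf₁ := hE.modular_left.isFlat
    have hf₂ := hE.modular_right.isFlat
    have hfin₁ : (M ↾ E₁).Finite :=
      Matroid.restrict_finite (M.ground_finite.subset hf₁.subset_ground)
    have hfin₂ : (M ↾ E₂).Finite :=
      Matroid.restrict_finite (M.ground_finite.subset hf₂.subset_ground)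
    -- The traces of E₁ and E₂ cover the round X, so one of them is all of X.
    have hcases : X ⊆ E₁ ∨ X ⊆ E₂ := by
      have := hround (X ∩ E₁) (X ∩ E₂)
        ((isFlat_restrict_flat_iff hX).2 ⟨isFlat_inter hX hf₁, Set.inter_subset_left⟩)
        ((isFlat_restrict_flat_iff hX).2 ⟨isFlat_inter hX hf₂, Set.inter_subset_left⟩)
        (by
          rw [← Set.inter_union_distrib_left, hE.union_eq]
          exact Set.inter_eq_left.2 hX.subset_ground)
      exact this.imp Set.inter_eq_left.1 Set.inter_eq_left.1
    rcases hcases with hX₁ | hX₂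
    · obtain ⟨e, he₂, heZ, hdvd, hW⟩ := ih₂ (X := E₁ ∩ E₂)
        ((isFlat_restrict_flat_iff hf₂).2 ⟨isFlat_inter hf₁ hf₂, Set.inter_subset_right⟩)
        (fun h => hE.proper_left (by
          rw [← hE.union_eq, Set.union_eq_left.2 (Set.inter_eq_right.1 h)]))
        (by rwa [M.restrict_restrict_eq Set.inter_subset_right])
      rw [Matroid.restrict_ground_eq] at he₂
      have he₁ : e ∉ E₁ := fun h => heZ ⟨h, he₂⟩
      exact ⟨e, hf₂.subset_ground he₂, fun h => he₁ (hX₁ h),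
        charPoly_contractElem_dvd hM hE.modular_right hf₁ hE.union_eq he₂ he₁ hdvd,
        weakModularlyExtended_contractElem_of_join hM hE hr h₁ he₂ he₁ hW⟩
    · have hE' : IsModularJoin M E₂ E₁ := ⟨hE.modular_right, hE.modular_left, hE.proper_right,
        hE.proper_left, by rw [Set.union_comm, hE.union_eq]⟩
      rw [Set.inter_comm] at hr
      obtain ⟨e, he₁, heZ, hdvd, hW⟩ := ih₁ (X := E₂ ∩ E₁)
        ((isFlat_restrict_flat_iff hf₁).2 ⟨isFlat_inter hf₂ hf₁, Set.inter_subset_right⟩)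
        (fun h => hE.proper_right (by
          rw [← hE'.union_eq, Set.union_eq_left.2 (Set.inter_eq_right.1 h)]))
        (by rwa [M.restrict_restrict_eq Set.inter_subset_right])
      rw [Matroid.restrict_ground_eq] at he₁
      have he₂ : e ∉ E₂ := fun h => heZ ⟨h, he₁⟩
      exact ⟨e, hf₁.subset_ground he₁, fun h => he₂ (hX₂ h),
        charPoly_contractElem_dvd hM hE.modular_left hf₂ hE'.union_eq he₁ he₂ hdvd,
        weakModularlyExtended_contractElem_of_join hM hE' hr h₂ he₁ he₂ hW⟩

theorem ModularlyExtended.isSimple (h : ModularlyExtended M) : IsSimple M := by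
  cases h with
  | empty => exact ⟨⟨by simp⟩, by simp⟩
  | modularCoatom _ X hM => exact hM
  | modularJoin _ E₁ E₂ hM => exact hM

theorem isRound_emptyOn : IsRound (Matroid.emptyOn α) := fun _ _ h₁ _ _ =>
  Or.inl (Set.subset_empty_iff.1 h₁.subset_ground)

theorem ModularlyExtended.exists_isDivisionalAtom (h : ModularlyExtended M) [M.Finite]
    (hne : M.E.Nonempty) :
    ∃ e, IsDivisionalAtom M e ∧ ModularlyExtended (si (M ／ {e})) := by
  obtain ⟨e, he, -, hdvd, hW⟩ := h.exists_divisional h.isSimple.isFlat_empty hne.ne_empty.symm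
    (by rw [Matroid.restrict_empty]; exact isRound_emptyOn)
  obtain ⟨S, hS, hd, hs⟩ := si_spec (M ／ {e})
  exact ⟨e, ⟨he, hdvd⟩, hS ▸ hW.restrict_of_isSimple hd (hs inferInstance)⟩

end Main

/-! ### Lifting divisional flags through contractions -/

section Flag

variable {α : Type*} {M N : Matroid α} {S X : Set α} {e : α}

theorem IsParallelDense.contract (hS : IsParallelDense N S) (X : Set α) :
    IsParallelDense (N ／ X) (S \ X) where
  subset_ground := Set.sdiff_subset_sdiff_left hS.subset_ground
  exists_mem x hx hxl := by
    rw [Matroid.contract_loops_eq] at hxl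
    have hxX : x ∉ N.closure X := fun h => hxl ⟨h, hx.2⟩
    obtain ⟨s, hs, hsx, hxs⟩ := hS.exists_mem x hx.1 fun h =>
      hxX (N.closure_subset_closure (Set.empty_subset _) h)
    have hsX : s ∉ X := fun h => hxX (N.closure_subset_closure (by simpa) hxs)
    refine ⟨s, ⟨hs, hsX⟩, ?_, ?_⟩ <;> rw [Matroid.contract_closure_eq]
    · exact ⟨N.closure_subset_closure Set.subset_union_left hsx, hsX⟩
    · exact ⟨N.closure_subset_closure Set.subset_union_left hxs, hx.2⟩

theorem isParallelDense_of_compl_loops (hS : S ⊆ N.E) (h : N.E \ N.loops ⊆ S) :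
    IsParallelDense N S :=
  ⟨hS, fun x hx hxl => ⟨x, h ⟨hx, hxl⟩, N.mem_closure_self x hx, N.mem_closure_self x hx⟩⟩

/-- Contracting cl X instead of X only deletes loops of N/X. -/
theorem charPoly_contract_closure [N.Finite] (X : Set α) :
    charPoly (N ／ N.closure X) = charPoly (N ／ X) := by
  have heq : N ／ N.closure X = (N ／ X) ↾ ((N ／ X).E \ (N.closure X \ X)) := by
    rw [N.contract_closure_eq_contract_delete, Matroid.delete_eq_restrict]
  have : ((N ／ X) ↾ ((N ／ X).E \ (N.closure X \ X))).Finite := heq ▸ inferInstance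
  rw [charPoly_eq_of_eq heq]
  refine (isParallelDense_of_compl_loops Set.sdiff_subset ?_).charPoly_restrict
  rw [Matroid.contract_loops_eq]

theorem IsParallelDense.charPoly_restrict_contract [N.Finite] [(N ↾ S).Finite]
    (hS : IsParallelDense N S) (hX : X ⊆ S) :
    charPoly ((N ↾ S) ／ X) = charPoly (N ／ X) := by
  have heq := N.restrict_contract_eq_contract_restrict hX
  have : ((N ／ X) ↾ (S \ X)).Finite := heq ▸ inferInstance
  rw [charPoly_eq_of_eq heq, (hS.contract X).charPoly_restrict]

/-- The new flag is ∅ followed by the closures of Xᵢ + e, each of rank i + 1. Its first divisibility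
is that of the atom; the others are inherited, since contracting Xᵢ in (M/e)|S and cl(Xᵢ + e) in M
gives equal characteristic polynomials. -/
theorem HasDivisionalFlag.of_contractElem [M.Finite] [((M ／ {e}) ↾ S).Finite] (hM : IsSimple M)
    (he : e ∈ M.E) (hdvd : charPoly (M ／ {e}) ∣ charPoly M) (hS : IsParallelDense (M ／ {e}) S)
    (h : HasDivisionalFlag ((M ／ {e}) ↾ S)) : HasDivisionalFlag M := by
  obtain ⟨n, X, hX⟩ := h
  have hnl := hM.isNonloop he
  have hXS : ∀ i, X i ⊆ S := fun i => (hX.isFlat i).subset_ground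
  have hrk : ∀ i, rk M (insert e (X i)) = i + 1 := fun i => by
    rw [← rk_contractElem hnl, ← rk_restrict _ (hXS i), rk, hX.rank_flat i]
    simp
  have hspan : M.closure (insert e S) = M.E := by
    have h1 := congrArg (insert e) (hS.closure_inter (M ／ {e}).ground_isFlat)
    rwa [Set.inter_eq_right.2 hS.subset_ground, Matroid.contract_closure_eq,
      Matroid.contract_ground, Set.insert_sdiff_singleton, Set.insert_sdiff_singleton,
      Set.insert_eq_of_mem he, Set.union_singleton,
      Set.insert_eq_of_mem (M.mem_closure_of_mem' (Set.mem_insert _ _) he)] at h1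
  have hchar : ∀ i, charPoly (M ／ M.closure (insert e (X i))) =
      charPoly (((M ／ {e}) ↾ S) ／ X i) := fun i => by
    rw [hS.charPoly_restrict_contract (hXS i), charPoly_contract_closure]
    refine charPoly_eq_of_eq ?_
    rw [Matroid.contract_contract, Set.singleton_union]
  have hflat : ∀ i, M.IsFlat ((Fin.cons ∅ fun i => M.closure (insert e (X i)) :
      Fin (n + 2) → Set α) i) := by
    refine Fin.cases ?_ fun i => ?_
    · exact hM.isFlat_empty
    · exact M.isFlat_closure _
  refine ⟨n + 1, Fin.cons ∅ fun i => M.closure (insert e (X i)), ⟨?_, rfl, ?_, hflat, ?_, ?_, ?_⟩⟩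
  · rw [M.eRank_def, ← coe_rk, ← hspan, rk_closure]
    have := hrk (Fin.last n)
    rw [hX.last, Matroid.restrict_ground_eq] at this
    rw [this]
    simp
  · rw [← Fin.succ_last, Fin.cons_succ, hX.last]
    exact hspan
  · refine Fin.cases (by simp) fun i => ?_
    rw [Fin.cons_succ, ← coe_rk, rk_closure, hrk]
    simp
  · refine Fin.cases (Set.empty_subset _) fun i => ?_
    rw [← Fin.succ_castSucc, Fin.cons_succ, Fin.cons_succ]
    exact M.closure_subset_closure (Set.insert_subset_insert (hX.subset i))
  · refine Fin.cases ?_ fun i => ?_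
    · rw [Fin.cons_succ, Fin.castSucc_zero, Fin.cons_zero, hX.first]
      simpa [(hM.isFlat_singleton he).closure, charPoly_eq_of_eq M.contract_empty] using hdvd
    · rw [← Fin.succ_castSucc, Fin.cons_succ, Fin.cons_succ, hchar, hchar]
      exact hX.dvd i

theorem ModularlyExtended.hasDivisionalFlag (h : ModularlyExtended M) [M.Finite] :
    HasDivisionalFlag M := by
  induction hn : rk M M.E generalizing M with
  | zero =>
    have hM := h.isSimple
    have hE : M.E = ∅ := by
      by_contra hne
      obtain ⟨e, he⟩ := Set.nonempty_iff_ne_empty.2 hne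
      have := rk_mono M (Set.singleton_subset_iff.2 he)
      rw [rk_singleton (hM.isNonloop he)] at this
      omega
    refine ⟨0, fun _ => ∅, ⟨?_, rfl, hE.symm, fun _ => hM.isFlat_empty, ?_, fun i => i.elim0,
      fun i => i.elim0⟩⟩
    · rw [M.eRank_def, ← coe_rk, hn]
    · intro i
      simp
  | succ n ih =>
    have hne : M.E.Nonempty := by
      rw [Set.nonempty_iff_ne_empty]
      intro hE
      rw [hE, rk_empty] at hn
      omega
    obtain ⟨e, ⟨he, hdvd⟩, hme⟩ := h.exists_isDivisionalAtom hne
    obtain ⟨S, hS, hd, hs⟩ := si_spec (M ／ {e})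
    have := (hs inferInstance).finite
    rw [hS] at hme
    refine .of_contractElem h.isSimple he hdvd hd (ih hme ?_)
    have h1 := rk_contractElem (h.isSimple.isNonloop he) (M ／ {e}).E
    rw [Matroid.contract_ground, Set.insert_sdiff_singleton, Set.insert_eq_of_mem he, hn] at h1
    rw [Matroid.restrict_ground_eq, rk_restrict _ subset_rfl, hd.rk_eq, Matroid.contract_ground]
    omega

end Flag

end ModularConstruction

open ModularConstruction
theorem mainTheorem1 :
    (∀ {α : Type*} (M : Matroid α) [M.Finite], ModularlyExtended M → HasDivisionalFlag M) ∧
    (∀ {K V : Type*} [Field K] [AddCommGroup V] [Module K V] [FiniteDimensional K V]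
        (A : Arrangement K V), ModularlyExtended A.matroid → A.DivisionallyFree) ∧
    (∀ {α : Type*} (M : Matroid α) [M.Finite], ModularlyExtended M → M.E.Nonempty →
      ∃ e, IsDivisionalAtom M e ∧ ModularlyExtended (si (M ／ {e}))) :=
  ⟨fun _ _ h => h.hasDivisionalFlag, fun _ h => h.hasDivisionalFlag,
    fun _ _ h hne => h.exists_isDivisionalAtom hne⟩
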